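/- Let $\widehat K=\operatorname{conv}\{(0,0),(1,0),(0,1)\}$ be the reference triangle with barycentric coordinates $\lambda_1,\lambda_2,\lambda_3$ (belonging to the vertices in this order), and let $P^p(\widehat K)$ be the space of real polynomials in two variables of total degree at most $p$. Let $P_n^{(\alpha,\beta)}$ be the Jacobi polynomials, normalized by $P_n^{(\alpha,\beta)}(1)=\binom{n+\alpha}{n}$, let $\ell_n=P_n^{(0,0)}$ be the Legendre polynomials, let $L_n(s)=\int_{-1}^s\ell_{n-1}(t)\,dt$ for $n\ge1$, and let $P_n^{\mathcal S,(\alpha,\beta)}(s,t)=t^nP_n^{(\alpha,\beta)}(s/t)$ and $L_n^{\mathcal S}(s,t)=t^nL_n(s/t)$ be the scaled polynomials. For an integer $p\ge1$ consider (a) the vertex functions $\varphi^{\mathcal V}_j=\lambda_j$, $j=1,2,3$; (b) for each of the three edges $\mathcal E_m$, with end points $e_1,e_2$ taken in an arbitrary but fixed order, the edge functions $\varphi^{\mathcal E_m}_i=\sqrt{\tfrac{2i+3}{2}}\,L^{\mathcal S}_{i+2}(\lambda_{e_2}-\lambda_{e_1},\lambda_{e_1}+\lambda_{e_2})$, $0\le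 i\le p-2$; (c) the cell functions $\varphi^{\mathcal I}_{(ij)}=c_{ij}\,\lambda_1\lambda_2\lambda_3\,P_i^{\mathcal S,(2,2)}(\lambda_1-\lambda_2,\lambda_1+\lambda_2)\,P_j^{(2i+5,2)}(2\lambda_3-1)$, $i,j\ge 0$, $i+j\le p-3$, where $c_{ij}>0$ is such that $\|\varphi^{\mathcal I}_{(ij)}\|_{L^2(\widehat K)}=1$. Then there are constants $c_0,C_0,c_1,C_1>0$ such that, for every $p\ge1$ and every choice of the orientations of the edges, the functions (a)-(c) form a basis of $P^p(\widehat K)$, and for every $u\in P^p(\widehat K)$ the coefficients in the expansion $$u=\sum_{j=1}^3\alpha^{\mathcal V}_j\varphi^{\mathcal V}_j+\sum_{m=1}^3\sum_{i=0}^{p-2}\alpha^{\mathcal E_m}_i\varphi^{\mathcal E_m}_i+\sum_{i+j\le p-3}\alpha^{\mathcal I}_{(ij)}\varphi^{\mathcal I}_{(ij)}$$ satisfy, with $$\|\alpha\|^2:=\sum_{j=1}^3|\alpha^{\mathcal V}_j|^2+\sum_{m=1}^3\sum_{i=0}^{p-2}|\alpha^{\mathcal E_m}_i|^2+\sum_{i+j\le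 p-3}|\alpha^{\mathcal I}_{(ij)}|^2,$$ the estimates $$c_0\|u\|_{L^2(\widehat K)}^2\le\|\alpha\|^2\le C_0\,p^6\,\|u\|_{L^2(\widehat K)}^2,$$ $$c_1\,p^{-4}\,\|u\|_{H^1(\widehat K)}^2\le\|\alpha\|^2\le C_1\,p^2\,\|u\|_{H^1(\widehat K)}^2,$$ where $\|u\|_{H^1(\widehat K)}^2=\|u\|_{L^2(\widehat K)}^2+\|\nabla u\|_{L^2(\widehat K)}^2$. -/

import Mathlib

/-- The reference triangle `K̂ = conv {(0,0), (1,0), (0,1)}` in the plane. -/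
def refTriangle : Set (Fin 2 → ℝ) :=
  convexHull ℝ {![0, 0], ![1, 0], ![0, 1]}

/-- The Jacobi polynomial `P_n^{(α,β)}` in the standard normalization
`P_n^{(α,β)}(1) = binom (n + α) n`, for nonnegative integer parameters:
`P_n^{(α,β)}(x) = ∑ s, binom (n+α) (n-s) * binom (n+β) s * ((x-1)/2)^s * ((x+1)/2)^(n-s)`. -/
noncomputable def jacobiPoly (α β n : ℕ) : Polynomial ℝ :=
  ∑ s ∈ Finset.range (n + 1),
    Polynomial.C (((n + α).choose (n - s) * (n + β).choose s : ℕ) : ℝ) *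
      (Polynomial.C (1 / 2) * (Polynomial.X - 1)) ^ s *
      (Polynomial.C (1 / 2) * (Polynomial.X + 1)) ^ (n - s)

/-- The Legendre polynomial `ℓ_n = P_n^{(0,0)}`. -/
noncomputable def legendrePoly (n : ℕ) : Polynomial ℝ := jacobiPoly 0 0 n

/-- The integrated Legendre polynomial `L_n(s) = ∫_{-1}^s ℓ_{n-1}(t) dt`, for `n ≥ 1`
(see `eval_intLegendrePoly`): the antiderivative of `ℓ_{n-1}` that vanishes at `-1`. -/
noncomputable def intLegendrePoly (n : ℕ) : Polynomial ℝ :=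
  ∑ k ∈ Finset.range n,
    Polynomial.C ((legendrePoly (n - 1)).coeff k / (k + 1)) *
      (Polynomial.X ^ (k + 1) - Polynomial.C ((-1) ^ (k + 1)))

/-- The scaled polynomial `T^n * P(S/T)` for `P` of degree at most `n`, as a polynomial expression
in `S` and `T` (see `eval_scaledPoly`). -/
noncomputable def scaledPoly (n : ℕ) (P : Polynomial ℝ) (S T : MvPolynomial (Fin 2) ℝ) :
    MvPolynomial (Fin 2) ℝ :=
  MvPolynomial.aeval ![S, T] (P.homogenize n)

theorem natDegree_jacobiPoly_le (α β n : ℕ) : (jacobiPoly α β n).natDegree ≤ n := by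
  unfold jacobiPoly
  refine Polynomial.natDegree_sum_le_of_forall_le _ _ fun s hs => ?_
  have hs' : s ≤ n := Nat.lt_succ_iff.mp (Finset.mem_range.mp hs)
  have h1 : (Polynomial.C (1 / 2 : ℝ) * (Polynomial.X - 1)).natDegree ≤ 1 := by compute_degree
  have h2 : (Polynomial.C (1 / 2 : ℝ) * (Polynomial.X + 1)).natDegree ≤ 1 := by compute_degree
  refine Polynomial.natDegree_mul_le.trans ?_
  have h3 := Polynomial.natDegree_pow_le_of_le s h1
  have h4 := Polynomial.natDegree_pow_le_of_le (n - s) h2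
  have h5 := (Polynomial.natDegree_C_mul_le
    (((n + α).choose (n - s) * (n + β).choose s : ℕ) : ℝ)
    ((Polynomial.C (1 / 2 : ℝ) * (Polynomial.X - 1)) ^ s)).trans h3
  omega

theorem natDegree_intLegendrePoly_le (n : ℕ) : (intLegendrePoly n).natDegree ≤ n := by
  unfold intLegendrePoly
  refine Polynomial.natDegree_sum_le_of_forall_le _ _ fun k hk => ?_
  have hk' : k + 1 ≤ n := Finset.mem_range.mp hk
  refine (Polynomial.natDegree_C_mul_le _ _).trans ?_
  rw [Polynomial.natDegree_X_pow_sub_C]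
  exact hk'

theorem eval_intLegendrePoly {n : ℕ} (hn : 1 ≤ n) (s : ℝ) :
    (intLegendrePoly n).eval s = ∫ t in (-1)..s, (legendrePoly (n - 1)).eval t := by
  have hdeg : (legendrePoly (n - 1)).natDegree < n := by
    have := natDegree_jacobiPoly_le 0 0 (n - 1)
    unfold legendrePoly
    omega
  simp_rw [Polynomial.eval_eq_sum_range' hdeg]
  rw [intervalIntegral.integral_finsetSum]
  · simp only [intLegendrePoly, Polynomial.eval_finsetSum, Polynomial.eval_mul,
      Polynomial.eval_C, Polynomial.eval_sub, Polynomial.eval_pow, Polynomial.eval_X,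
      intervalIntegral.integral_const_mul, integral_pow]
    refine Finset.sum_congr rfl fun k _ => ?_
    ring
  · intro k _
    exact (by fun_prop : Continuous fun t : ℝ =>
      (legendrePoly (n - 1)).coeff k * t ^ k).intervalIntegrable _ _

theorem eval_scaledPoly {n : ℕ} {P : Polynomial ℝ} (hP : P.natDegree ≤ n)
    (S T : MvPolynomial (Fin 2) ℝ) (x : Fin 2 → ℝ) (hT : MvPolynomial.eval x T ≠ 0) :
    MvPolynomial.eval x (scaledPoly n P S T) =
      MvPolynomial.eval x T ^ n * P.eval (MvPolynomial.eval x S / MvPolynomial.eval x T) := by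
  have h : MvPolynomial.eval x (scaledPoly n P S T) =
      MvPolynomial.eval ![MvPolynomial.eval x S, MvPolynomial.eval x T] (P.homogenize n) := by
    unfold scaledPoly
    rw [MvPolynomial.aeval_def, MvPolynomial.eval₂_eq', map_sum, MvPolynomial.eval_eq']
    simp [MvPolynomial.algebraMap_eq, Fin.prod_univ_two]
  rw [h, Polynomial.eval_homogenize hP _ (by simpa using hT)]
  simp [mul_comm]

/-- The barycentric coordinates on the reference triangle, with respect to its vertices
`(0,0)`, `(1,0)`, `(0,1)` in this order. -/
noncomputable def bary : Fin 3 → MvPolynomial (Fin 2) ℝ :=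
  ![1 - MvPolynomial.X 0 - MvPolynomial.X 1, MvPolynomial.X 0, MvPolynomial.X 1]

/-- `‖f‖²_{L²(K̂)}` for a polynomial function `f`. -/
noncomputable def l2NormSq (f : MvPolynomial (Fin 2) ℝ) : ℝ :=
  ∫ x in refTriangle, (MvPolynomial.eval x f) ^ 2

/-- `‖f‖²_{H¹(K̂)} = ‖f‖²_{L²(K̂)} + ‖∇ f‖²_{L²(K̂)}` for a polynomial function `f`. -/
noncomputable def h1NormSq (f : MvPolynomial (Fin 2) ℝ) : ℝ :=
  l2NormSq f + ∑ i : Fin 2, l2NormSq (MvPolynomial.pderiv i f)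

/-- The first vertex `e₁` of the `m`-th edge. The three edges join the vertices `m` and `m + 1`
(cyclically); `o m` says which of their two orientations is chosen. -/
def edgeStart (o : Fin 3 → Bool) (m : Fin 3) : Fin 3 := if o m then m else m + 1

/-- The second vertex `e₂` of the `m`-th edge. -/
def edgeEnd (o : Fin 3 → Bool) (m : Fin 3) : Fin 3 := if o m then m + 1 else m

/-- The edge function
`√((2i+3)/2) * L^S_{i+2}(λ_{e₂} - λ_{e₁}, λ_{e₁} + λ_{e₂})` of the edge from `e₁` to `e₂`. -/
noncomputable def edgeFun (e₁ e₂ : Fin 3) (i : ℕ) : MvPolynomial (Fin 2) ℝ :=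
  MvPolynomial.C (Real.sqrt ((2 * i + 3) / 2)) *
    scaledPoly (i + 2) (intLegendrePoly (i + 2)) (bary e₂ - bary e₁) (bary e₁ + bary e₂)

/-- The cell based function before normalization:
`λ₁ λ₂ λ₃ P_i^{S,(2,2)}(λ₁ - λ₂, λ₁ + λ₂) P_j^{(2i+5,2)}(2 λ₃ - 1)`. -/
noncomputable def cellFunRaw (i j : ℕ) : MvPolynomial (Fin 2) ℝ :=
  bary 0 * bary 1 * bary 2 *
    scaledPoly i (jacobiPoly 2 2 i) (bary 0 - bary 1) (bary 0 + bary 1) *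
    Polynomial.aeval (2 * bary 2 - 1) (jacobiPoly (2 * i + 5) 2 j)

/-- The cell based function, normalized in `L²(K̂)`. -/
noncomputable def cellFun (i j : ℕ) : MvPolynomial (Fin 2) ℝ :=
  MvPolynomial.C (1 / Real.sqrt (l2NormSq (cellFunRaw i j))) * cellFunRaw i j

/-- The indices of the basis functions of degree `p`: the three vertices, the pairs `(m, i)` of an
edge `m` and an `i` with `0 ≤ i ≤ p - 2`, and the pairs `(i, j)` with `0 ≤ i + j ≤ p - 3`
(none if `p ≤ 2`). -/
abbrev BasisIndex (p : ℕ) : Type :=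
  Fin 3 ⊕ (Fin 3 × Fin (p - 1)) ⊕ (Σ i : Fin (p - 2), Fin (p - 2 - i))

/-- The hierarchical basis functions of degree `p` on the reference triangle, for the edge
orientations `o`. -/
noncomputable def basisFun (o : Fin 3 → Bool) (p : ℕ) : BasisIndex p → MvPolynomial (Fin 2) ℝ
  | .inl j => bary j
  | .inr (.inl (m, i)) => edgeFun (edgeStart o m) (edgeEnd o m) i
  | .inr (.inr ⟨i, j⟩) => cellFun i j

/-- The sum of the squares of the vertex, edge and cell coefficients. -/
noncomputable def coeffNormSq {p : ℕ} (α : BasisIndex p → ℝ) : ℝ :=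
  ∑ j : Fin 3, |α (.inl j)| ^ 2 +
    ∑ m : Fin 3, ∑ i : Fin (p - 1), |α (.inr (.inl (m, i)))| ^ 2 +
    ∑ i : Fin (p - 2), ∑ j : Fin (p - 2 - i), |α (.inr (.inr ⟨i, j⟩))| ^ 2

/-!
Write `u = V + E + I` for the vertex, edge and cell parts of an expansion in the hierarchical basis.

*Bounds of `u` by the coefficients.* The vertex functions are bounded by one. In coordinates that
collapse the triangle to the vertex opposite to an edge (`duffy`), a combination of the functions of
this edge is, on each segment parallel to the edge, a combination of integrated Legendre polynomials
that vanishes at both ends. Suitably scaled, these are orthonormal in `H¹₀(-1, 1)`, so the Poincaré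
inequality bounds the `L²` norm by the coefficients (`l2NormSq_sum_edgeFun_le`). In the same
coordinates the cell functions are products of Jacobi polynomials whose parameters match the
weights, hence they are `L²` orthonormal (`integral_cellFun_mul`). This gives the lower bound with
`‖u‖_{L²}`, and the Markov inequality `‖∇u‖_{L²} ≤ C p² ‖u‖_{L²}` (`l2NormSq_pderiv_le`) gives the
one with `‖u‖_{H¹}`.

*Bounds of the coefficients by `u`.* The vertex coefficients are the values of `u` at the vertices.
On an edge, `u` is an affine function plus a combination of the `√((2i+3)/2) L_{i+2}`; as their
derivatives are `L²` orthonormal and orthogonal to the constants, the coefficients of the edge are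
bounded by the `L²` norm of the tangential derivative of `u` on the edge (`sum_edgeCoeff_sq_le`).
The discrete trace inequality `‖v‖²_{L²(edge)} ≤ C p² ‖v‖²_{L²}` (`integral_edgeTrace_sq_le`),
applied to `∇u`, yields the factor `p²` in the `H¹` estimate. Applied to `u` and combined with
the Markov inequality on the edge, which costs another `p⁴`, it yields the factor `p⁶` in the `L²`
estimate. The vertex values are bounded by one-dimensional inequalities on an edge, at no higher
cost. Finally `I = u - V - E`, and its `L²` norm is that of the cell coefficients, so only constants
are lost.

Both the Markov and the trace inequality on the triangle follow from their one-dimensional versions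
on segments of a fixed length. The triangle is the union of the images of the square `[0, 1/2]²`
under its affine symmetries `permMap σ`, and within these parallelograms such segments exist.

The functions are linearly independent by the upper `L²` estimate, and their number is the dimension
of the polynomial space.
-/

/-! ### Jacobi and Legendre polynomials -/

open Polynomial in
/-- The Rodrigues formula, for the weight `(x - 1) ^ α * (x + 1) ^ β`. -/
theorem iterate_derivative_rodrigues (α β n : ℕ) :
    derivative^[n] ((X - 1 : ℝ[X]) ^ (α + n) * (X + 1) ^ (β + n)) =
      C (2 ^ n * (n.factorial : ℝ)) * ((X - 1) ^ α * (X + 1) ^ β * jacobiPoly α β n) := by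
  have hm : (X - 1 : ℝ[X]) = X - C 1 := by simp
  have hp : (X + 1 : ℝ[X]) = X + C 1 := by simp
  rw [iterate_derivative_mul, jacobiPoly, Finset.mul_sum, Finset.mul_sum]
  refine Finset.sum_congr rfl fun s hs => ?_
  have hs' : s ≤ n := Nat.lt_succ_iff.mp (Finset.mem_range.mp hs)
  rw [hm, hp, iterate_derivative_X_sub_pow, iterate_derivative_X_add_pow]
  have e1 : α + n - (n - s) = α + s := by omega
  have e2 : β + n - s = β + (n - s) := by omega
  rw [e1, e2, Nat.descFactorial_eq_factorial_mul_choose, Nat.descFactorial_eq_factorial_mul_choose]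
  have h2 : (2 : ℝ) ^ n * (1 / 2) ^ s * (1 / 2) ^ (n - s) = 1 := by
    rw [mul_assoc, ← pow_add, Nat.add_sub_cancel' hs', ← mul_pow]; norm_num
  have hf : (n.factorial : ℝ) = n.choose s * s.factorial * (n - s).factorial := by
    exact_mod_cast (Nat.choose_mul_factorial_mul_factorial hs').symm
  simp only [nsmul_eq_mul, mul_pow, ← C_pow, ← C_eq_natCast, Nat.cast_mul, pow_add]
  have hc : (n.choose s : ℝ) * ((n - s).factorial * ((α + n).choose (n - s))) *
      (s.factorial * (β + n).choose s) = 2 ^ n * n.factorial *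
      ((n + α).choose (n - s) * (n + β).choose s) * (1 / 2) ^ s * (1 / 2) ^ (n - s) := by
    rw [add_comm n α, add_comm n β, hf]
    linear_combination (-(n.choose s : ℝ) * ((n - s).factorial * ((α + n).choose (n - s))) *
      (s.factorial * (β + n).choose s)) * h2
  have hC := congrArg (C : ℝ → ℝ[X]) hc
  simp only [C_mul] at hC ⊢
  linear_combination ((X - C 1) ^ α * (X - C 1) ^ s * ((X + C 1) ^ β * (X + C 1) ^ (n - s))) * hC

theorem integral_eval_derivative (q : Polynomial ℝ) (a b : ℝ) :
    ∫ x in a..b, (Polynomial.derivative q).eval x = q.eval b - q.eval a :=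
  intervalIntegral.integral_eq_sub_of_hasDerivAt (fun x _ => q.hasDerivAt x)
    ((Polynomial.continuous _).intervalIntegrable _ _)

theorem intervalIntegrable_eval (q : Polynomial ℝ) (a b : ℝ) :
    IntervalIntegrable (fun x => q.eval x) MeasureTheory.volume a b :=
  q.continuous.intervalIntegrable _ _

open Polynomial in
/-- Integration by parts `n` times, without boundary terms. -/
theorem integral_iterate_derivative_mul (n : ℕ) (F q : ℝ[X])
    (hF : ∀ k < n, (derivative^[k] F).eval 1 = 0 ∧ (derivative^[k] F).eval (-1) = 0) :
    ∫ x in (-1 : ℝ)..1, (derivative^[n] F * q).eval x =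
      (-1) ^ n * ∫ x in (-1 : ℝ)..1, (F * derivative^[n] q).eval x := by
  induction n generalizing q with
  | zero => simp
  | succ n ih =>
    have h1 := integral_eval_derivative (derivative^[n] F * q) (-1) 1
    rw [eval_mul, eval_mul, (hF n (by omega)).1, (hF n (by omega)).2, derivative_mul] at h1
    simp only [eval_add] at h1
    rw [intervalIntegral.integral_add (intervalIntegrable_eval _ _ _)
      (intervalIntegrable_eval _ _ _), ih _ fun k hk => hF k (by omega)] at h1
    rw [Function.iterate_succ_apply', Function.iterate_succ_apply]
    linear_combination h1

open Polynomial in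
/-- The Jacobi polynomial of degree `n` is orthogonal to all polynomials of smaller degree with
respect to the weight `(x - 1) ^ α * (x + 1) ^ β`, which up to sign is the usual one. -/
theorem integral_jacobiPoly_mul_eq_zero (α β n : ℕ) {q : ℝ[X]} (hq : q.degree < n) :
    ∫ x in (-1 : ℝ)..1, ((X - 1) ^ α * (X + 1) ^ β * jacobiPoly α β n * q).eval x = 0 := by
  have h := integral_iterate_derivative_mul n ((X - 1) ^ (α + n) * (X + 1) ^ (β + n)) q ?_
  · rw [iterate_derivative_rodrigues, iterate_derivative_eq_zero_of_degree_lt hq] at h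
    simp only [mul_zero, eval_zero, intervalIntegral.integral_zero, mul_assoc, eval_C_mul,
      intervalIntegral.integral_const_mul] at h
    have hn : (n.factorial : ℝ) ≠ 0 := by positivity
    simpa [mul_assoc, hn] using h
  · intro k hk
    have hd (r : ℝ[X]) (hr : r ^ n ∣ (X - 1) ^ (α + n) * (X + 1) ^ (β + n)) :
        r ∣ derivative^[k] ((X - 1 : ℝ[X]) ^ (α + n) * (X + 1) ^ (β + n)) :=
      (dvd_pow_self r (by omega)).trans (pow_sub_dvd_iterate_derivative_of_pow_dvd k hr)
    constructor
    · exact eval_eq_zero_of_dvd_of_eval_eq_zero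
        (hd (X - 1) (Dvd.dvd.mul_right (pow_dvd_pow _ (by omega)) _)) (by simp)
    · exact eval_eq_zero_of_dvd_of_eval_eq_zero
        (hd (X + 1) (Dvd.dvd.mul_left (pow_dvd_pow _ (by omega)) _)) (by simp)

open Polynomial in
theorem eval_one_jacobiPoly (α β n : ℕ) : (jacobiPoly α β n).eval 1 = (n + α).choose n := by
  rw [jacobiPoly, eval_finsetSum, Finset.sum_eq_single 0]
  · norm_num
  · intro s _ hs
    simp [hs]
  · simp

theorem jacobiPoly_ne_zero (α β n : ℕ) : jacobiPoly α β n ≠ 0 := by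
  intro h
  have := eval_one_jacobiPoly α β n
  rw [h, Polynomial.eval_zero] at this
  have h2 : 0 < (n + α).choose n := Nat.choose_pos (by omega)
  exact absurd this.symm (by exact_mod_cast h2.ne')

open Polynomial in
theorem natDegree_jacobiPoly (α β n : ℕ) : (jacobiPoly α β n).natDegree = n := by
  refine natDegree_eq_of_le_of_coeff_ne_zero (natDegree_jacobiPoly_le α β n) ?_
  rw [jacobiPoly, finsetSum_coeff]
  -- every summand has degree `n` and a positive leading coefficient
  have h (s : ℕ) (hs : s ∈ Finset.range (n + 1)) :
      (C (((n + α).choose (n - s) * (n + β).choose s : ℕ) : ℝ) * (C (1 / 2) * (X - 1)) ^ s *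
      (C (1 / 2) * (X + 1)) ^ (n - s)).coeff n =
        (((n + α).choose (n - s) * (n + β).choose s : ℕ) : ℝ) * (1 / 2) ^ n := by
    have hs' : s ≤ n := Nat.lt_succ_iff.mp (Finset.mem_range.mp hs)
    have hm : ((X - 1 : ℝ[X]) ^ s * (X + 1) ^ (n - s)).coeff n = 1 := by
      have hM : ((X - 1 : ℝ[X]) ^ s * (X + 1) ^ (n - s)).Monic := by
        have h1 : (X - 1 : ℝ[X]).Monic := by simpa using monic_X_sub_C (1 : ℝ)
        have h2 : (X + 1 : ℝ[X]).Monic := by simpa using monic_X_add_C (1 : ℝ)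
        exact (h1.pow s).mul (h2.pow (n - s))
      have hd : ((X - 1 : ℝ[X]) ^ s * (X + 1) ^ (n - s)).natDegree = n := by
        rw [natDegree_mul (pow_ne_zero _ (by simpa using X_sub_C_ne_zero (1 : ℝ)))
          (pow_ne_zero _ (by simpa using X_add_C_ne_zero (1 : ℝ))), natDegree_pow, natDegree_pow]
        have e1 : (X - 1 : ℝ[X]).natDegree = 1 := by simpa using natDegree_X_sub_C (1 : ℝ)
        have e2 : (X + 1 : ℝ[X]).natDegree = 1 := by simpa using natDegree_X_add_C (1 : ℝ)
        rw [e1, e2]; omega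
      simpa [Monic, leadingCoeff, hd] using hM
    have e : C (((n + α).choose (n - s) * (n + β).choose s : ℕ) : ℝ) * (C (1 / 2) * (X - 1)) ^ s *
        (C (1 / 2) * (X + 1)) ^ (n - s) =
        C (((n + α).choose (n - s) * (n + β).choose s : ℕ) * (1 / 2) ^ n : ℝ) *
          ((X - 1) ^ s * (X + 1) ^ (n - s)) := by
      conv_rhs => rw [← Nat.add_sub_cancel' hs', pow_add]
      rw [Nat.add_sub_cancel' hs']
      simp only [mul_pow, C_mul, C_pow]
      ring
    rw [e, coeff_C_mul, hm, mul_one]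
  rw [Finset.sum_congr rfl h]
  refine (Finset.sum_pos' (fun s _ => by positivity) ⟨0, by simp, ?_⟩).ne'
  have : 0 < (n + α).choose n := Nat.choose_pos (by omega)
  simp only [Nat.sub_zero, Nat.choose_zero_right, mul_one]
  positivity

theorem degree_jacobiPoly (α β n : ℕ) : (jacobiPoly α β n).degree = n := by
  rw [Polynomial.degree_eq_natDegree (jacobiPoly_ne_zero α β n), natDegree_jacobiPoly]

open Polynomial in
theorem integral_jacobiPoly_mul_jacobiPoly (α β : ℕ) {m n : ℕ} (h : m ≠ n) :
    ∫ x in (-1 : ℝ)..1,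
      ((X - 1) ^ α * (X + 1) ^ β * jacobiPoly α β m * jacobiPoly α β n).eval x = 0 := by
  rcases lt_or_gt_of_ne h with h | h
  · rw [mul_right_comm]
    exact integral_jacobiPoly_mul_eq_zero α β n (by rw [degree_jacobiPoly]; exact_mod_cast h)
  · exact integral_jacobiPoly_mul_eq_zero α β m (by rw [degree_jacobiPoly]; exact_mod_cast h)

theorem integral_eval_pos {q : Polynomial ℝ} (hq : q ≠ 0) {a b : ℝ} (hab : a < b)
    (h : ∀ x ∈ Set.Icc a b, 0 ≤ q.eval x) :
    0 < ∫ x in a..b, q.eval x := by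
  refine intervalIntegral.integral_pos hab q.continuous.continuousOn
    (fun x hx => h x (Set.Ioc_subset_Icc_self hx)) ?_
  by_contra! hc
  refine hq (Polynomial.eq_zero_of_infinite_isRoot q ((Set.Icc_infinite hab).mono fun x hx => ?_))
  exact le_antisymm (hc x hx) (h x hx)

theorem degree_legendrePoly (n : ℕ) : (legendrePoly n).degree = n := degree_jacobiPoly 0 0 n

theorem natDegree_legendrePoly (n : ℕ) : (legendrePoly n).natDegree = n :=
  natDegree_jacobiPoly 0 0 n

theorem integral_legendrePoly_mul_eq_zero (n : ℕ) {q : Polynomial ℝ} (hq : q.degree < n) :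
    ∫ x in (-1 : ℝ)..1, (legendrePoly n).eval x * q.eval x = 0 := by
  simpa [legendrePoly] using integral_jacobiPoly_mul_eq_zero 0 0 n hq

theorem eval_one_legendrePoly (n : ℕ) : (legendrePoly n).eval 1 = 1 := by
  simpa [legendrePoly] using eval_one_jacobiPoly 0 0 n

open Polynomial in
theorem eval_neg_one_legendrePoly (n : ℕ) : (legendrePoly n).eval (-1) = (-1) ^ n := by
  rw [legendrePoly, jacobiPoly, eval_finsetSum, Finset.sum_eq_single n]
  · norm_num
  · intro s hs hsn
    have : n - s ≠ 0 := by have := Finset.mem_range.mp hs; omega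
    simp [this]
  · simp

open Polynomial in
theorem integral_legendrePoly_sq (n : ℕ) :
    ∫ x in (-1 : ℝ)..1, (legendrePoly n).eval x ^ 2 = 2 / (2 * n + 1) := by
  set l := legendrePoly n with hl
  -- `x ℓ' - n ℓ` has degree less than `n`, so `∫ x ℓ ℓ' = n ∫ ℓ²`
  have hdeg : (X * derivative l - C (n : ℝ) * l).degree < (n : WithBot ℕ) := by
    rw [degree_lt_iff_coeff_zero]
    intro m hm
    rw [coeff_sub, coeff_C_mul]
    cases m with
    | zero =>
      obtain rfl : n = 0 := by omega
      simp
    | succ m =>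
      rw [coeff_X_mul, coeff_derivative]
      rcases hm.eq_or_lt with h | h
      · rw [h]; push_cast; ring
      · rw [coeff_eq_zero_of_natDegree_lt (by rw [natDegree_legendrePoly]; exact h)]; ring
  have h1 := integral_legendrePoly_mul_eq_zero n hdeg
  have h2 := integral_eval_derivative (X * l ^ 2) (-1) 1
  have e1 : ∀ x : ℝ, l.eval x * (X * derivative l - C (n : ℝ) * l).eval x =
      x * l.eval x * (derivative l).eval x - n * l.eval x ^ 2 := by
    intro x; simp only [eval_sub, eval_mul, eval_X, eval_C]; ring
  have e2 : ∀ x : ℝ, (derivative (X * l ^ 2)).eval x =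
      l.eval x ^ 2 + 2 * (x * l.eval x * (derivative l).eval x) := by
    intro x
    simp only [derivative_mul, derivative_X, one_mul, derivative_pow, eval_add, eval_mul, eval_X,
      eval_pow, eval_C]
    push_cast; simp; ring
  have i1 : IntervalIntegrable (fun x => x * l.eval x * (derivative l).eval x)
      MeasureTheory.volume (-1) 1 := (by fun_prop : Continuous _).intervalIntegrable _ _
  have i2 : IntervalIntegrable (fun x => l.eval x ^ 2)
      MeasureTheory.volume (-1) 1 := (by fun_prop : Continuous _).intervalIntegrable _ _
  simp only [← hl, e1] at h1
  simp only [e2] at h2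
  rw [intervalIntegral.integral_sub i1 (i2.const_mul _), intervalIntegral.integral_const_mul] at h1
  rw [intervalIntegral.integral_add i2 (i1.const_mul _), intervalIntegral.integral_const_mul] at h2
  have h3 : (X * l ^ 2).eval 1 - (X * l ^ 2).eval (-1) = 2 := by
    simp only [eval_mul, eval_X, eval_pow, hl, eval_one_legendrePoly, eval_neg_one_legendrePoly]
    rw [← pow_mul, mul_comm n 2, pow_mul]; norm_num
  rw [h3] at h2
  rw [eq_div_iff (by positivity)]
  linear_combination h2 - 2 * h1

theorem exists_eq_sum_legendrePoly {p : ℕ} {q : Polynomial ℝ} (hq : q.natDegree ≤ p) :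
    ∃ a : ℕ → ℝ, q = ∑ n ∈ Finset.range (p + 1), Polynomial.C (a n) * legendrePoly n := by
  have key : ∀ N : ℕ, ∀ q : Polynomial ℝ, q.degree < N →
      ∃ a : ℕ → ℝ, q = ∑ n ∈ Finset.range N, Polynomial.C (a n) * legendrePoly n := by
    intro N
    induction N with
    | zero =>
      intro q hq
      exact ⟨0, by simpa using Polynomial.degree_eq_bot.mp (by simpa using hq)⟩
    | succ N ih =>
      intro q hq
      have hlc : (legendrePoly N).coeff N ≠ 0 := by
        have := Polynomial.leadingCoeff_ne_zero.mpr (jacobiPoly_ne_zero 0 0 N)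
        rwa [Polynomial.leadingCoeff, natDegree_jacobiPoly] at this
      -- subtract the multiple of `ℓ_N` that cancels the leading coefficient
      obtain ⟨a, ha⟩ := ih (q - Polynomial.C (q.coeff N / (legendrePoly N).coeff N) *
          legendrePoly N) (by
        rw [Polynomial.degree_lt_iff_coeff_zero] at hq ⊢
        intro m hm
        rw [Polynomial.coeff_sub, Polynomial.coeff_C_mul]
        rcases Nat.eq_or_lt_of_le hm with h | h
        · rw [← h, div_mul_cancel₀ _ hlc, sub_self]
        · have h0 : (legendrePoly N).coeff m = 0 :=
            Polynomial.coeff_eq_zero_of_natDegree_lt (by rwa [natDegree_legendrePoly])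
          rw [hq m (by omega), h0]
          simp)
      refine ⟨Function.update a N (q.coeff N / (legendrePoly N).coeff N), ?_⟩
      rw [Finset.sum_range_succ, Function.update_self, ← sub_eq_iff_eq_add, ha]
      refine Finset.sum_congr rfl fun n hn => ?_
      rw [Function.update_of_ne (Finset.mem_range.mp hn).ne]
  refine key (p + 1) q ?_
  exact (Polynomial.degree_le_of_natDegree_le hq).trans_lt (by exact_mod_cast p.lt_succ_self)

theorem integral_legendrePoly_mul_legendrePoly (m n : ℕ) :
    ∫ x in (-1 : ℝ)..1, (legendrePoly m).eval x * (legendrePoly n).eval x =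
      if m = n then (2 / (2 * n + 1) : ℝ) else 0 := by
  split_ifs with h
  · subst h
    simpa [sq] using integral_legendrePoly_sq m
  · simpa [legendrePoly] using integral_jacobiPoly_mul_jacobiPoly 0 0 h

theorem integral_sum_legendrePoly_sq (s : Finset ℕ) (a : ℕ → ℝ) :
    ∫ x in (-1 : ℝ)..1, (∑ n ∈ s, a n * (legendrePoly n).eval x) ^ 2 =
      ∑ n ∈ s, a n ^ 2 * (2 / (2 * n + 1)) := by
  simp_rw [sq (∑ n ∈ s, _), Finset.sum_mul_sum]
  rw [intervalIntegral.integral_finsetSum fun i _ =>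
    (by fun_prop : Continuous _).intervalIntegrable _ _]
  refine Finset.sum_congr rfl fun m hm => ?_
  rw [intervalIntegral.integral_finsetSum fun i _ =>
    (by fun_prop : Continuous _).intervalIntegrable _ _]
  simp_rw [mul_mul_mul_comm, intervalIntegral.integral_const_mul,
    integral_legendrePoly_mul_legendrePoly]
  simp [hm, sq]

/-- The Cauchy–Schwarz inequality that bounds any linear functional of `∑ a_n ℓ_n` by the norm of
`∑ a_n ℓ_n`: here `b_n` is the value of the functional at `ℓ_n`. -/
theorem sum_mul_sq_le_integral_mul {p : ℕ} (a b : ℕ → ℝ) :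
    (∑ n ∈ Finset.range (p + 1), a n * b n) ^ 2 ≤
      (∫ x in (-1 : ℝ)..1, (∑ n ∈ Finset.range (p + 1), a n * (legendrePoly n).eval x) ^ 2) *
        ∑ n ∈ Finset.range (p + 1), (2 * n + 1) / 2 * b n ^ 2 := by
  rw [integral_sum_legendrePoly_sq]
  refine Finset.sum_sq_le_sum_mul_sum_of_sq_le_mul _ (fun n _ => by positivity)
    (fun n _ => by positivity) fun n _ => le_of_eq ?_
  have : (2 * n + 1 : ℝ) ≠ 0 := by positivity
  field_simp

theorem sum_range_odd_half (p : ℕ) :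
    ∑ n ∈ Finset.range (p + 1), ((2 * n + 1) / 2 : ℝ) = (p + 1) ^ 2 / 2 := by
  induction p with
  | zero => simp
  | succ p ih => rw [Finset.sum_range_succ, ih]; push_cast; ring

/-! ### Inequalities for polynomials on an interval -/

/-- The sharp bound of the end point values of a polynomial by its `L²` norm. -/
theorem eval_sq_le_integral {p : ℕ} {q : Polynomial ℝ} (hq : q.natDegree ≤ p) {x : ℝ}
    (hx : x = 1 ∨ x = -1) :
    q.eval x ^ 2 ≤ (p + 1) ^ 2 / 2 * ∫ y in (-1 : ℝ)..1, q.eval y ^ 2 := by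
  obtain ⟨a, rfl⟩ := exists_eq_sum_legendrePoly hq
  have h := sum_mul_sq_le_integral_mul (p := p) a fun n => (legendrePoly n).eval x
  have h1 (n : ℕ) : (legendrePoly n).eval x ^ 2 = 1 := by
    rcases hx with rfl | rfl
    · simp [eval_one_legendrePoly]
    · rw [eval_neg_one_legendrePoly, ← pow_mul, mul_comm, pow_mul]; simp
  simp only [h1, mul_one, sum_range_odd_half] at h
  simpa [Polynomial.eval_finsetSum, mul_comm] using h

/-- The exact value is `n * (n + 1)`. The bound follows from integration by parts, which expresses
the integral by the end point values of `ℓ_n'`, as these are bounded by its square root. -/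
theorem integral_derivative_legendrePoly_sq_le (n : ℕ) :
    ∫ x in (-1 : ℝ)..1, (Polynomial.derivative (legendrePoly n)).eval x ^ 2 ≤ 2 * n ^ 2 := by
  rcases Nat.eq_zero_or_pos n with rfl | hn
  · have : Polynomial.derivative (legendrePoly 0) = 0 :=
      Polynomial.derivative_of_natDegree_zero (natDegree_legendrePoly 0)
    simp [this]
  set l := legendrePoly n with hl
  set d := Polynomial.derivative l with hd
  set N := ∫ x in (-1 : ℝ)..1, d.eval x ^ 2 with hN
  have hdeg : d.natDegree ≤ n - 1 := by
    have := Polynomial.natDegree_derivative_le l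
    rwa [hl, natDegree_legendrePoly] at this
  -- integration by parts: `N = ℓ(1) ℓ'(1) - ℓ(-1) ℓ'(-1)`, as `ℓ''` has smaller degree than `ℓ`
  have hparts : N = d.eval 1 - (-1) ^ n * d.eval (-1) := by
    have h1 := integral_eval_derivative (l * d) (-1) 1
    have h2 : ∫ x in (-1 : ℝ)..1, l.eval x * (Polynomial.derivative d).eval x = 0 := by
      refine integral_legendrePoly_mul_eq_zero n ?_
      refine Polynomial.degree_lt_degree ?_ |>.trans_eq (degree_legendrePoly n)
      rw [natDegree_legendrePoly]
      have := Polynomial.natDegree_derivative_le d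
      omega
    rw [Polynomial.derivative_mul, ← hd] at h1
    simp only [Polynomial.eval_add, Polynomial.eval_mul] at h1
    simp only [← sq] at h1
    rw [intervalIntegral.integral_add ((by fun_prop : Continuous _).intervalIntegrable _ _)
      ((by fun_prop : Continuous _).intervalIntegrable _ _), h2, add_zero, ← hN, hl,
      eval_one_legendrePoly, eval_neg_one_legendrePoly] at h1
    rw [h1]; ring
  have hN0 : 0 ≤ N := intervalIntegral.integral_nonneg (by norm_num) fun x _ => by positivity
  have b1 := eval_sq_le_integral hdeg (Or.inl rfl)
  have b2 := eval_sq_le_integral hdeg (Or.inr rfl)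
  rw [Nat.cast_sub hn, Nat.cast_one, sub_add_cancel, ← hN] at b1 b2
  have hs : ((-1 : ℝ) ^ n) ^ 2 = 1 := by rw [← pow_mul, mul_comm, pow_mul]; simp
  have h3 : N ^ 2 ≤ 2 * n ^ 2 * N := by
    have : N ^ 2 ≤ 2 * (d.eval 1 ^ 2 + d.eval (-1) ^ 2) := by
      rw [hparts]
      nlinarith [sq_nonneg (d.eval 1 + (-1) ^ n * d.eval (-1))]
    linarith
  rcases hN0.eq_or_lt with h | h
  · rw [← h]; positivity
  · nlinarith

/-- The Markov inequality in `L²(-1, 1)`, with a constant that is not optimal. -/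
theorem integral_derivative_sq_le {p : ℕ} {q : Polynomial ℝ} (hq : q.natDegree ≤ p) :
    ∫ x in (-1 : ℝ)..1, (Polynomial.derivative q).eval x ^ 2 ≤
      6 * p ^ 4 * ∫ x in (-1 : ℝ)..1, q.eval x ^ 2 := by
  rcases Nat.eq_zero_or_pos p with rfl | hp
  · have : Polynomial.derivative q = 0 := Polynomial.derivative_of_natDegree_zero (by omega)
    simp [this]
  obtain ⟨a, rfl⟩ := exists_eq_sum_legendrePoly hq
  simp only [Polynomial.derivative_sum, Polynomial.derivative_C_mul, Polynomial.eval_finsetSum,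
    Polynomial.eval_C_mul]
  set I := ∫ x in (-1 : ℝ)..1, (∑ n ∈ Finset.range (p + 1), a n * (legendrePoly n).eval x) ^ 2
  have hI : 0 ≤ I := intervalIntegral.integral_nonneg (by norm_num) fun x _ => by positivity
  have hp' : (1 : ℝ) ≤ p := by exact_mod_cast hp
  calc ∫ x in (-1 : ℝ)..1, (∑ n ∈ Finset.range (p + 1),
          a n * (Polynomial.derivative (legendrePoly n)).eval x) ^ 2
      ≤ ∫ x in (-1 : ℝ)..1, I * ∑ n ∈ Finset.range (p + 1),
          (2 * n + 1) / 2 * (Polynomial.derivative (legendrePoly n)).eval x ^ 2 :=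
        intervalIntegral.integral_mono_on (by norm_num)
          ((by fun_prop : Continuous _).intervalIntegrable _ _)
          ((by fun_prop : Continuous _).intervalIntegrable _ _)
          fun x _ => sum_mul_sq_le_integral_mul a _
    _ = I * ∑ n ∈ Finset.range (p + 1), (2 * n + 1) / 2 *
          ∫ x in (-1 : ℝ)..1, (Polynomial.derivative (legendrePoly n)).eval x ^ 2 := by
        rw [intervalIntegral.integral_const_mul, intervalIntegral.integral_finsetSum fun i _ =>
          (by fun_prop : Continuous _).intervalIntegrable _ _]
        simp_rw [intervalIntegral.integral_const_mul]
    _ ≤ I * ∑ n ∈ Finset.range (p + 1), (3 * p / 2 * (2 * p ^ 2) : ℝ) := by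
        gcongr with n hn
        · exact intervalIntegral.integral_nonneg (by norm_num) fun x _ => by positivity
        · have : (n : ℝ) ≤ p := by exact_mod_cast Nat.lt_succ_iff.mp (Finset.mem_range.mp hn)
          linarith
        · have : (n : ℝ) ≤ p := by exact_mod_cast Nat.lt_succ_iff.mp (Finset.mem_range.mp hn)
          refine (integral_derivative_legendrePoly_sq_le n).trans ?_
          gcongr
    _ = 3 * p ^ 3 * (p + 1) * I := by
        rw [Finset.sum_const, Finset.card_range, nsmul_eq_mul]; push_cast; ring
    _ ≤ 6 * p ^ 4 * I := by
        refine mul_le_mul_of_nonneg_right ?_ hI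
        nlinarith [pow_pos (by linarith : (0 : ℝ) < p) 3]

/-- The bound of the value at an end point by the `H¹` norm on `(-1, 1)`. -/
theorem eval_one_sq_le_integral_add (q : Polynomial ℝ) :
    q.eval 1 ^ 2 ≤ 3 / 2 * (∫ x in (-1 : ℝ)..1, q.eval x ^ 2) +
      ∫ x in (-1 : ℝ)..1, (Polynomial.derivative q).eval x ^ 2 := by
  have h1 := integral_eval_derivative ((Polynomial.X + 1) * q ^ 2) (-1) 1
  have i1 : IntervalIntegrable (fun x => q.eval x ^ 2)
      MeasureTheory.volume (-1) 1 := (by fun_prop : Continuous _).intervalIntegrable _ _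
  have i2 : IntervalIntegrable (fun x => (Polynomial.derivative q).eval x ^ 2)
      MeasureTheory.volume (-1) 1 := (by fun_prop : Continuous _).intervalIntegrable _ _
  have h2 : ∫ x in (-1 : ℝ)..1,
      (Polynomial.derivative ((Polynomial.X + 1) * q ^ 2)).eval x ≤
      ∫ x in (-1 : ℝ)..1, (3 * q.eval x ^ 2 + 2 * (Polynomial.derivative q).eval x ^ 2) := by
    refine intervalIntegral.integral_mono_on (by norm_num) (intervalIntegrable_eval _ _ _)
      ((i1.const_mul _).add (i2.const_mul _)) fun x hx => ?_
    simp [Polynomial.derivative_pow]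
    set u := q.eval x
    set v := (Polynomial.derivative q).eval x
    nlinarith [mul_nonneg (by linarith [hx.1] : 0 ≤ x + 1) (sq_nonneg (u - v)),
      mul_nonneg (by linarith [hx.2] : 0 ≤ 1 - x) (add_nonneg (sq_nonneg u) (sq_nonneg v))]
  rw [h1, intervalIntegral.integral_add (i1.const_mul _) (i2.const_mul _),
    intervalIntegral.integral_const_mul, intervalIntegral.integral_const_mul] at h2
  norm_num at h2
  linarith

/-- The Poincaré inequality for polynomials that vanish at the end points. -/
theorem integral_sq_le_of_eval_eq_zero {q : Polynomial ℝ} (h₁ : q.eval 1 = 0)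
    (h₂ : q.eval (-1) = 0) :
    ∫ x in (-1 : ℝ)..1, q.eval x ^ 2 ≤
      4 * ∫ x in (-1 : ℝ)..1, (Polynomial.derivative q).eval x ^ 2 := by
  have h1 := integral_eval_derivative (Polynomial.X * q ^ 2) (-1) 1
  have i1 : IntervalIntegrable (fun x => q.eval x ^ 2)
      MeasureTheory.volume (-1) 1 := (by fun_prop : Continuous _).intervalIntegrable _ _
  have i2 : IntervalIntegrable (fun x => (Polynomial.derivative q).eval x ^ 2)
      MeasureTheory.volume (-1) 1 := (by fun_prop : Continuous _).intervalIntegrable _ _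
  have h2 : ∫ x in (-1 : ℝ)..1,
      (1 / 2 * q.eval x ^ 2 - 2 * (Polynomial.derivative q).eval x ^ 2) ≤
      ∫ x in (-1 : ℝ)..1, (Polynomial.derivative (Polynomial.X * q ^ 2)).eval x := by
    refine intervalIntegral.integral_mono_on (by norm_num)
      ((i1.const_mul _).sub (i2.const_mul _)) (intervalIntegrable_eval _ _ _) fun x hx => ?_
    simp [Polynomial.derivative_pow]
    set u := q.eval x
    set v := (Polynomial.derivative q).eval x
    have hx2 : x ^ 2 ≤ 1 := by nlinarith [hx.1, hx.2]
    nlinarith [sq_nonneg (u + 2 * x * v), mul_nonneg (sub_nonneg.mpr hx2) (sq_nonneg v)]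
  rw [h1, intervalIntegral.integral_sub (i1.const_mul _) (i2.const_mul _),
    intervalIntegral.integral_const_mul, intervalIntegral.integral_const_mul] at h2
  simp [h₁, h₂] at h2
  linarith

theorem integral_eval_comp_affine (q : Polynomial ℝ) :
    ∫ x in (-1 : ℝ)..1, q.eval (1 / 4 * x + 1 / 4) = 4 * ∫ x in (0 : ℝ)..1 / 2, q.eval x := by
  rw [intervalIntegral.integral_comp_mul_add (fun x => q.eval x) (by norm_num : (1 / 4 : ℝ) ≠ 0)]
  norm_num

/-- The reparametrization of `[0, 1/2]` by `[-1, 1]`, applied to a polynomial. -/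
noncomputable def compHalf (q : Polynomial ℝ) : Polynomial ℝ :=
  q.comp (Polynomial.C (1 / 4) * Polynomial.X + Polynomial.C (1 / 4))

theorem eval_compHalf (q : Polynomial ℝ) (x : ℝ) :
    (compHalf q).eval x = q.eval (1 / 4 * x + 1 / 4) := by
  simp [compHalf]

theorem natDegree_compHalf_le (q : Polynomial ℝ) : (compHalf q).natDegree ≤ q.natDegree := by
  refine Polynomial.natDegree_comp_le.trans ?_
  have : (Polynomial.C (1 / 4 : ℝ) * Polynomial.X + Polynomial.C (1 / 4)).natDegree ≤ 1 := by
    compute_degree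
  nlinarith

theorem integral_compHalf_sq (q : Polynomial ℝ) :
    ∫ x in (-1 : ℝ)..1, (compHalf q).eval x ^ 2 = 4 * ∫ x in (0 : ℝ)..1 / 2, q.eval x ^ 2 := by
  have h := integral_eval_comp_affine (q ^ 2)
  simp_rw [Polynomial.eval_pow] at h
  simp_rw [eval_compHalf]
  exact h

theorem eval_zero_sq_le_integral_half {p : ℕ} (hp : 1 ≤ p) {q : Polynomial ℝ}
    (hq : q.natDegree ≤ p) :
    q.eval 0 ^ 2 ≤ 8 * p ^ 2 * ∫ x in (0 : ℝ)..1 / 2, q.eval x ^ 2 := by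
  have h := eval_sq_le_integral ((natDegree_compHalf_le q).trans hq) (Or.inr rfl)
  rw [integral_compHalf_sq, eval_compHalf] at h
  norm_num at h ⊢
  refine h.trans ?_
  have hI : 0 ≤ ∫ x in (0 : ℝ)..1 / 2, q.eval x ^ 2 :=
    intervalIntegral.integral_nonneg (by norm_num) fun x _ => by positivity
  norm_num at hI
  rw [← mul_assoc]
  refine mul_le_mul_of_nonneg_right ?_ hI
  have hp' : (1 : ℝ) ≤ p := by exact_mod_cast hp
  nlinarith

theorem integral_half_derivative_sq_le {p : ℕ} {q : Polynomial ℝ} (hq : q.natDegree ≤ p) :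
    ∫ x in (0 : ℝ)..1 / 2, (Polynomial.derivative q).eval x ^ 2 ≤
      96 * p ^ 4 * ∫ x in (0 : ℝ)..1 / 2, q.eval x ^ 2 := by
  have h := integral_derivative_sq_le ((natDegree_compHalf_le q).trans hq)
  have hd : Polynomial.derivative (compHalf q) =
      Polynomial.C (1 / 4) * compHalf (Polynomial.derivative q) := by
    simp [compHalf, Polynomial.derivative_comp]
  simp only [hd, Polynomial.eval_C_mul, mul_pow] at h
  rw [intervalIntegral.integral_const_mul, integral_compHalf_sq, integral_compHalf_sq] at h
  linarith

/-! ### The reference triangle and its symmetries -/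

/-- The gradients of the barycentric coordinates. -/
def baryGrad : Fin 3 → Fin 2 → ℝ := ![![-1, -1], ![1, 0], ![0, 1]]

/-- The values of the barycentric coordinates at a point. -/
def baryAt (x : Fin 2 → ℝ) : Fin 3 → ℝ := ![1 - x 0 - x 1, x 0, x 1]

theorem eval_bary (x : Fin 2 → ℝ) (i : Fin 3) :
    MvPolynomial.eval x (bary i) = baryAt x i := by
  fin_cases i <;> simp [bary, baryAt]

theorem sum_baryAt (x : Fin 2 → ℝ) : ∑ i, baryAt x i = 1 := by
  simp [baryAt, Fin.sum_univ_three]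
  ring

theorem baryAt_add_smul (x d : Fin 2 → ℝ) (t : ℝ) (i : Fin 3) :
    baryAt (x + t • d) i = baryAt x i + t * ∑ j, baryGrad i j * d j := by
  fin_cases i <;> simp [baryAt, baryGrad]
  ring

theorem continuous_baryAt (i : Fin 3) : Continuous fun x => baryAt x i := by
  fin_cases i <;> simp [baryAt] <;> fun_prop

theorem mem_refTriangle_iff (x : Fin 2 → ℝ) : x ∈ refTriangle ↔ ∀ i, 0 ≤ baryAt x i := by
  constructor
  · intro hx
    have hconv : Convex ℝ {y : Fin 2 → ℝ | ∀ i, 0 ≤ baryAt y i} := by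
      intro y hy z hz a b ha hb hab i
      have : baryAt (a • y + b • z) i = a * baryAt y i + b * baryAt z i := by
        obtain rfl : a = 1 - b := by linarith
        fin_cases i <;> simp [baryAt]
        ring
      rw [this]
      exact add_nonneg (mul_nonneg ha (hy i)) (mul_nonneg hb (hz i))
    refine convexHull_min ?_ hconv hx
    rintro y (rfl | rfl | rfl) i <;> fin_cases i <;> simp [baryAt]
  · intro hx
    unfold refTriangle
    have hz : ∀ i ∈ (Finset.univ : Finset (Fin 3)),
        (![![0, 0], ![1, 0], ![0, 1]] : Fin 3 → Fin 2 → ℝ) i ∈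
        convexHull ℝ {![0, 0], ![1, 0], ![0, 1]} := by
      intro i _
      refine subset_convexHull ℝ _ ?_
      fin_cases i <;> simp
    have h := (convex_convexHull ℝ _).sum_mem (fun i _ => hx i) (sum_baryAt x) hz
    convert h using 1
    ext j
    fin_cases j <;> simp [Fin.sum_univ_three, baryAt]

theorem isCompact_refTriangle : IsCompact refTriangle :=
  Set.Finite.isCompact_convexHull (𝕜 := ℝ) (Set.toFinite _)

theorem measurableSet_refTriangle : MeasurableSet refTriangle :=
  isCompact_refTriangle.isClosed.measurableSet

theorem integrableOn_refTriangle {f : (Fin 2 → ℝ) → ℝ} (hf : Continuous f) :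
    MeasureTheory.IntegrableOn f refTriangle :=
  hf.continuousOn.integrableOn_compact isCompact_refTriangle

/-- The affine map of the plane that permutes the barycentric coordinates. -/
def permMap (σ : Equiv.Perm (Fin 3)) (x : Fin 2 → ℝ) : Fin 2 → ℝ :=
  fun i => baryAt x (σ i.succ)

theorem baryAt_permMap (σ : Equiv.Perm (Fin 3)) (x : Fin 2 → ℝ) (i : Fin 3) :
    baryAt (permMap σ x) i = baryAt x (σ i) := by
  have h := Equiv.sum_comp σ (baryAt x)
  rw [sum_baryAt, Fin.sum_univ_three] at h
  fin_cases i
  · simp [baryAt, permMap] at h ⊢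
    linarith
  · simp [baryAt, permMap]
  · simp [baryAt, permMap]

theorem ext_baryAt {x y : Fin 2 → ℝ} (h : ∀ i, baryAt x i = baryAt y i) : x = y := by
  ext i
  have h1 := h 1
  have h2 := h 2
  fin_cases i
  · simpa [baryAt] using h1
  · simpa [baryAt] using h2

theorem permMap_inv_permMap (σ : Equiv.Perm (Fin 3)) (x : Fin 2 → ℝ) :
    permMap σ⁻¹ (permMap σ x) = x :=
  ext_baryAt fun i => by simp [baryAt_permMap]

theorem continuous_permMap (σ : Equiv.Perm (Fin 3)) : Continuous (permMap σ) :=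
  continuous_pi fun i => continuous_baryAt (σ i.succ)

theorem abs_det_baryGrad {a b : Fin 3} (h : a ≠ b) :
    |(Matrix.of ![baryGrad a, baryGrad b]).det| = 1 := by
  fin_cases a <;> fin_cases b <;> simp [baryGrad, Matrix.det_fin_two] at h ⊢

theorem measurePreserving_permMap (σ : Equiv.Perm (Fin 3)) :
    MeasureTheory.MeasurePreserving (permMap σ) := by
  set A : Matrix (Fin 2) (Fin 2) ℝ := Matrix.of ![baryGrad (σ 1), baryGrad (σ 2)] with hA
  have hdet : |A.det| = 1 := abs_det_baryGrad (by simp)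
  have h1 : MeasureTheory.MeasurePreserving (Matrix.toLin' A) := by
    refine ⟨(LinearMap.continuous_on_pi _).measurable, ?_⟩
    rw [Real.map_matrix_volume_pi_eq_smul_volume_pi (by intro h; simp [h] at hdet), abs_inv, hdet]
    simp
  have h2 := (MeasureTheory.measurePreserving_add_left MeasureTheory.volume (permMap σ 0)).comp h1
  suffices h : permMap σ = (fun x => permMap σ 0 + x) ∘ Matrix.toLin' A by rw [h]; exact h2
  funext x
  ext i
  have h (k : Fin 3) : baryAt x k = baryAt 0 k + ∑ j, baryGrad k j * x j := by
    simpa using baryAt_add_smul 0 x 1 k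
  fin_cases i <;> simp [permMap, hA, h (σ 1), h (σ 2)]

theorem integral_permMap (σ : Equiv.Perm (Fin 3)) (f : (Fin 2 → ℝ) → ℝ) :
    ∫ x in refTriangle, f (permMap σ x) = ∫ x in refTriangle, f x := by
  have hemb : MeasurableEmbedding (permMap σ) :=
    (continuous_permMap σ).measurableEmbedding
      (Function.LeftInverse.injective (permMap_inv_permMap σ))
  rw [← (measurePreserving_permMap σ).setIntegral_preimage_emb hemb f refTriangle]
  congr 2
  ext x
  simp only [Set.mem_preimage, mem_refTriangle_iff, baryAt_permMap]
  exact ⟨fun h i => h (σ i), fun h i => by simpa using h (σ⁻¹ i)⟩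

theorem setIntegral_eq_setIntegral_prod (s : Set (Fin 2 → ℝ)) (f : (Fin 2 → ℝ) → ℝ) :
    ∫ x in s, f x = ∫ z in {z : ℝ × ℝ | ![z.1, z.2] ∈ s}, f ![z.1, z.2] := by
  have h := (MeasureTheory.volume_preserving_finTwoArrow ℝ).symm
  exact (h.setIntegral_preimage_emb (MeasurableEquiv.measurableEmbedding _) f s).symm

/-! ### Integration over the triangle -/

theorem integral_refTriangle {f : (Fin 2 → ℝ) → ℝ} (hf : Continuous f) :
    ∫ x in refTriangle, f x = ∫ y in (0 : ℝ)..1, ∫ x in (0 : ℝ)..1 - y, f ![x, y] := by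
  rw [setIntegral_eq_setIntegral_prod]
  set S : Set (ℝ × ℝ) := {z | ![z.1, z.2] ∈ refTriangle} with hS
  have hcont : Continuous fun z : ℝ × ℝ => ![z.1, z.2] := by fun_prop
  have hSm : MeasurableSet S := measurableSet_refTriangle.preimage hcont.measurable
  have hmem (x y : ℝ) : (x, y) ∈ S ↔ x ∈ Set.Icc 0 (1 - y) ∧ y ∈ Set.Icc (0 : ℝ) 1 := by
    simp only [hS, Set.mem_ofPred_eq, mem_refTriangle_iff, Fin.forall_fin_succ, baryAt, Set.mem_Icc]
    simp
    constructor
    · rintro ⟨h1, h2, h3⟩; exact ⟨⟨h2, by linarith⟩, h3, by linarith⟩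
    · rintro ⟨⟨h1, h2⟩, h3, h4⟩; exact ⟨by linarith, h1, h3⟩
  have hint : MeasureTheory.Integrable (S.indicator fun z : ℝ × ℝ => f ![z.1, z.2]) := by
    rw [MeasureTheory.integrable_indicator_iff hSm]
    refine ((hf.comp hcont).continuousOn.integrableOn_compact
      (isCompact_Icc (a := ((0 : ℝ), (0 : ℝ))) (b := ((1 : ℝ), (1 : ℝ))))).mono_set ?_
    rintro ⟨x, y⟩ hz
    rw [hmem] at hz
    obtain ⟨⟨h1, h2⟩, h3, h4⟩ := hz
    exact ⟨⟨h1, h3⟩, ⟨by simp; linarith, h4⟩⟩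
  rw [← MeasureTheory.integral_indicator hSm, MeasureTheory.Measure.volume_eq_prod,
    MeasureTheory.integral_prod_symm _ hint, intervalIntegral.integral_of_le zero_le_one,
    ← MeasureTheory.integral_Icc_eq_integral_Ioc, ← MeasureTheory.integral_indicator
      measurableSet_Icc]
  refine MeasureTheory.integral_congr_ae (Filter.Eventually.of_forall fun y => ?_)
  by_cases hy : y ∈ Set.Icc (0 : ℝ) 1
  · rw [Set.indicator_of_mem hy, intervalIntegral.integral_of_le (by linarith [hy.2]),
      ← MeasureTheory.integral_Icc_eq_integral_Ioc, ← MeasureTheory.integral_indicator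
      measurableSet_Icc]
    refine MeasureTheory.integral_congr_ae (Filter.Eventually.of_forall fun x => ?_)
    by_cases hx : x ∈ Set.Icc 0 (1 - y)
    · beta_reduce
      rw [Set.indicator_of_mem hx, Set.indicator_of_mem ((hmem x y).2 ⟨hx, hy⟩)]
    · beta_reduce
      rw [Set.indicator_of_notMem hx, Set.indicator_of_notMem fun h => hx ((hmem x y).1 h).1]
  · rw [Set.indicator_of_notMem hy]
    refine MeasureTheory.integral_eq_zero_of_ae (Filter.Eventually.of_forall fun x => ?_)
    exact Set.indicator_of_notMem (fun h => hy ((hmem x y).1 h).2) _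

/-- The point of the reference triangle with `λ₁ = t (1 + s) / 2`, `λ₂ = t (1 - s) / 2` and
`λ₃ = 1 - t`. -/
noncomputable def duffy (t s : ℝ) : Fin 2 → ℝ := ![t * (1 - s) / 2, 1 - t]

theorem baryAt_duffy (t s : ℝ) :
    baryAt (duffy t s) = ![t * (1 + s) / 2, t * (1 - s) / 2, 1 - t] := by
  ext i
  fin_cases i <;> simp [baryAt, duffy]; ring

theorem integral_refTriangle_duffy {f : (Fin 2 → ℝ) → ℝ} (hf : Continuous f) :
    ∫ x in refTriangle, f x =
      ∫ t in (0 : ℝ)..1, t / 2 * ∫ s in (-1 : ℝ)..1, f (duffy t s) := by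
  rw [integral_refTriangle hf]
  have h := intervalIntegral.integral_comp_sub_left (a := 0) (b := 1)
    (fun y => ∫ x in (0 : ℝ)..1 - y, f ![x, y]) 1
  rw [sub_self, sub_zero] at h
  rw [← h]
  refine intervalIntegral.integral_congr fun t _ => ?_
  have h2 := intervalIntegral.mul_integral_comp_mul_add (a := -1) (b := 1)
    (f := fun x => f ![x, 1 - t]) (c := -t / 2) (d := t / 2)
  simp only [sub_sub_cancel]
  rw [intervalIntegral.integral_symm]
  have e1 : -t / 2 * -1 + t / 2 = t := by ring
  have e2 : -t / 2 * 1 + t / 2 = 0 := by ring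
  rw [e1, e2] at h2
  rw [← h2]
  have e3 : ∀ s, -t / 2 * s + t / 2 = t * (1 - s) / 2 := fun s => by ring
  simp only [e3, duffy]
  ring

/-! ### Covering the triangle by parallelograms -/

/-- The square at the first vertex of the reference triangle; its images under the affine
symmetries cover the triangle. -/
def vertexSquare : Set (Fin 2 → ℝ) := {x | ∀ i, x i ∈ Set.Icc (0 : ℝ) (1 / 2)}

theorem vertexSquare_subset : vertexSquare ⊆ refTriangle := by
  intro x hx
  rw [mem_refTriangle_iff]
  have h0 := hx 0
  have h1 := hx 1
  intro i
  fin_cases i <;> simp [baryAt]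
  · linarith [h0.2, h1.2]
  · exact h0.1
  · exact h1.1

theorem isClosed_vertexSquare : IsClosed vertexSquare := by
  simp only [vertexSquare, Set.ofPred_forall]
  exact isClosed_iInter fun i => isClosed_Icc.preimage (continuous_apply i)

theorem integral_vertexSquare {f : (Fin 2 → ℝ) → ℝ} (hf : Continuous f) :
    ∫ x in vertexSquare, f x = ∫ x in (0 : ℝ)..1 / 2, ∫ y in (0 : ℝ)..1 / 2, f ![x, y] := by
  rw [setIntegral_eq_setIntegral_prod]
  have hS : {z : ℝ × ℝ | ![z.1, z.2] ∈ vertexSquare} =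
      Set.Icc (0 : ℝ) (1 / 2) ×ˢ Set.Icc (0 : ℝ) (1 / 2) := by
    ext z
    simp only [vertexSquare, Fin.forall_fin_two, Set.mem_prod]
    rfl
  have hcont : Continuous fun z : ℝ × ℝ => ![z.1, z.2] := by fun_prop
  rw [hS, MeasureTheory.Measure.volume_eq_prod, MeasureTheory.setIntegral_prod
    (fun z : ℝ × ℝ => f ![z.1, z.2])
    ((hf.comp hcont).continuousOn.integrableOn_compact (isCompact_Icc.prod isCompact_Icc))]
  simp only [intervalIntegral.integral_of_le (by norm_num : (0 : ℝ) ≤ 1 / 2),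
    MeasureTheory.integral_Icc_eq_integral_Ioc]

theorem integral_vertexSquare_symm {f : (Fin 2 → ℝ) → ℝ} (hf : Continuous f) :
    ∫ x in vertexSquare, f x = ∫ y in (0 : ℝ)..1 / 2, ∫ x in (0 : ℝ)..1 / 2, f ![x, y] := by
  rw [integral_vertexSquare hf]
  refine MeasureTheory.intervalIntegral_intervalIntegral_swap ?_
  have hcont : Continuous (Function.uncurry fun x y : ℝ => f ![x, y]) := by
    have : Continuous fun z : ℝ × ℝ => ![z.1, z.2] := by fun_prop
    exact hf.comp this
  exact (hcont.continuousOn.integrableOn_compact (isCompact_uIcc.prod isCompact_uIcc)).mono_set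
    (Set.prod_mono Set.uIoc_subset_uIcc Set.uIoc_subset_uIcc)

theorem integral_vertexSquare_le {f : (Fin 2 → ℝ) → ℝ} (hf : Continuous f) (h0 : ∀ x, 0 ≤ f x)
    (σ : Equiv.Perm (Fin 3)) :
    ∫ x in vertexSquare, f (permMap σ x) ≤ ∫ x in refTriangle, f x := by
  rw [← integral_permMap σ f]
  exact MeasureTheory.setIntegral_mono_set
    (integrableOn_refTriangle (hf.comp (continuous_permMap σ)))
    (Filter.Eventually.of_forall fun x => h0 _)
    (Filter.Eventually.of_forall vertexSquare_subset)

theorem exists_permMap_mem_vertexSquare {x : Fin 2 → ℝ} (hx : x ∈ refTriangle) :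
    ∃ σ : Equiv.Perm (Fin 3), permMap σ⁻¹ x ∈ vertexSquare := by
  rw [mem_refTriangle_iff] at hx
  have hsum := sum_baryAt x
  rw [Fin.sum_univ_three] at hsum
  have key (τ : Equiv.Perm (Fin 3)) (h1 : baryAt x (τ 1) ≤ 1 / 2) (h2 : baryAt x (τ 2) ≤ 1 / 2) :
      ∃ σ : Equiv.Perm (Fin 3), permMap σ⁻¹ x ∈ vertexSquare := by
    refine ⟨τ⁻¹, fun i => ?_⟩
    rw [inv_inv]
    exact ⟨hx _, by fin_cases i <;> assumption⟩
  have h0 := hx 0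
  have h1 := hx 1
  have h2 := hx 2
  by_cases c1 : baryAt x 1 ≤ 1 / 2
  · by_cases c2 : baryAt x 2 ≤ 1 / 2
    · exact key 1 c1 c2
    · refine key (Equiv.swap 0 2) ?_ ?_
      · rwa [Equiv.swap_apply_of_ne_of_ne (by decide) (by decide)]
      · rw [Equiv.swap_apply_right]; linarith
  · refine key (Equiv.swap 0 1) ?_ ?_
    · rw [Equiv.swap_apply_right]; linarith
    · rw [Equiv.swap_apply_of_ne_of_ne (by decide) (by decide)]; linarith

theorem integral_refTriangle_le_sum {f : (Fin 2 → ℝ) → ℝ} (hf : Continuous f)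
    (h0 : ∀ x, 0 ≤ f x) :
    ∫ x in refTriangle, f x ≤
      ∑ σ : Equiv.Perm (Fin 3), ∫ x in vertexSquare, f (permMap σ x) := by
  have hm (σ : Equiv.Perm (Fin 3)) : MeasurableSet (permMap σ⁻¹ ⁻¹' vertexSquare) :=
    isClosed_vertexSquare.measurableSet.preimage (continuous_permMap σ⁻¹).measurable
  have hint (σ : Equiv.Perm (Fin 3)) : MeasureTheory.IntegrableOn
      ((permMap σ⁻¹ ⁻¹' vertexSquare).indicator f) refTriangle :=
    MeasureTheory.Integrable.indicator (integrableOn_refTriangle hf) (hm σ)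
  have heq (σ : Equiv.Perm (Fin 3)) : ∫ x in vertexSquare, f (permMap σ x) =
      ∫ x in refTriangle, (permMap σ⁻¹ ⁻¹' vertexSquare).indicator f x := by
    rw [← integral_permMap σ]
    have e (x : Fin 2 → ℝ) : (permMap σ⁻¹ ⁻¹' vertexSquare).indicator f (permMap σ x) =
        vertexSquare.indicator (fun y => f (permMap σ y)) x := by
      have h : permMap σ x ∈ permMap σ⁻¹ ⁻¹' vertexSquare ↔ x ∈ vertexSquare := by
        rw [Set.mem_preimage, permMap_inv_permMap]
      by_cases hx : x ∈ vertexSquare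
      · rw [Set.indicator_of_mem hx, Set.indicator_of_mem (h.2 hx)]
      · rw [Set.indicator_of_notMem hx, Set.indicator_of_notMem fun h' => hx (h.1 h')]
    simp only [e]
    rw [MeasureTheory.setIntegral_indicator isClosed_vertexSquare.measurableSet,
      Set.inter_eq_right.mpr vertexSquare_subset]
  simp_rw [heq]
  rw [← MeasureTheory.integral_finsetSum _ fun σ _ => hint σ]
  refine MeasureTheory.setIntegral_mono_on (integrableOn_refTriangle hf)
    (MeasureTheory.integrable_finsetSum _ fun σ _ => hint σ) measurableSet_refTriangle
    fun x hx => ?_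
  obtain ⟨σ, hσ⟩ := exists_permMap_mem_vertexSquare hx
  have hnn : ∀ τ ∈ (Finset.univ : Finset (Equiv.Perm (Fin 3))),
      0 ≤ (permMap τ⁻¹ ⁻¹' vertexSquare).indicator f x :=
    fun τ _ => Set.indicator_nonneg (fun y _ => h0 y) x
  refine le_trans (le_of_eq ?_) (Finset.single_le_sum hnn (Finset.mem_univ σ))
  exact (Set.indicator_of_mem (show x ∈ permMap σ⁻¹ ⁻¹' vertexSquare from hσ) f).symm

/-! ### Markov and trace inequalities on the triangle -/

/-- The restriction of a polynomial in two variables to the line `t ↦ a + t • d`. -/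
noncomputable def lineRestrict (u : MvPolynomial (Fin 2) ℝ) (a d : Fin 2 → ℝ) : Polynomial ℝ :=
  MvPolynomial.aeval (fun i => Polynomial.C (a i) + Polynomial.C (d i) * Polynomial.X) u

theorem eval_lineRestrict (u : MvPolynomial (Fin 2) ℝ) (a d : Fin 2 → ℝ) (t : ℝ) :
    (lineRestrict u a d).eval t = MvPolynomial.eval (a + t • d) u := by
  have h : (Polynomial.evalRingHom t).comp
      ((MvPolynomial.aeval (R := ℝ) fun i => Polynomial.C (a i) +
        Polynomial.C (d i) * Polynomial.X) : MvPolynomial (Fin 2) ℝ →+* Polynomial ℝ) =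
      MvPolynomial.eval (a + t • d) := by
    refine MvPolynomial.ringHom_ext (fun r => ?_) fun i => ?_
    · simp
    · simp only [RingHom.comp_apply, RingHom.coe_coe, MvPolynomial.aeval_X,
        MvPolynomial.eval_X, map_add, map_mul, Polynomial.coe_evalRingHom, Polynomial.eval_C,
        Polynomial.eval_X, Pi.add_apply, Pi.smul_apply, smul_eq_mul]
      ring
  exact congrArg (fun φ : MvPolynomial (Fin 2) ℝ →+* ℝ => φ u) h

theorem natDegree_lineRestrict_le {p : ℕ} {u : MvPolynomial (Fin 2) ℝ} (hu : u.totalDegree ≤ p)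
    (a d : Fin 2 → ℝ) : (lineRestrict u a d).natDegree ≤ p := by
  rw [← mul_one p]
  refine MvPolynomial.aeval_natDegree_le u hu _ fun i => ?_
  compute_degree

theorem derivative_lineRestrict (u : MvPolynomial (Fin 2) ℝ) (a d : Fin 2 → ℝ) :
    Polynomial.derivative (lineRestrict u a d) =
      ∑ i, Polynomial.C (d i) * lineRestrict (MvPolynomial.pderiv i u) a d := by
  induction u using MvPolynomial.induction_on with
  | C r => simp [lineRestrict]
  | add u v hu hv =>
    simp only [lineRestrict, map_add] at hu hv ⊢
    rw [hu, hv, ← Finset.sum_add_distrib]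
    exact Finset.sum_congr rfl fun i _ => by ring
  | mul_X u j hu =>
    simp only [lineRestrict, map_mul, MvPolynomial.aeval_X, Polynomial.derivative_mul,
      MvPolynomial.pderiv_mul, map_add] at hu ⊢
    rw [hu, Finset.sum_mul]
    simp only [mul_add, Finset.sum_add_distrib, MvPolynomial.pderiv_X]
    fin_cases j <;> simp [Fin.sum_univ_two] <;> ring

theorem continuous_eval_sq (u : MvPolynomial (Fin 2) ℝ) :
    Continuous fun x => MvPolynomial.eval x u ^ 2 :=
  (MvPolynomial.continuous_eval u).pow 2

theorem l2NormSq_nonneg (u : MvPolynomial (Fin 2) ℝ) : 0 ≤ l2NormSq u :=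
  MeasureTheory.integral_nonneg fun x => by positivity

theorem permMap_add_smul (σ : Equiv.Perm (Fin 3)) (a d : Fin 2 → ℝ) (t : ℝ) :
    permMap σ (a + t • d) =
      permMap σ a + t • fun i : Fin 2 => ∑ j, baryGrad (σ i.succ) j * d j := by
  ext i
  simp [permMap, baryAt_add_smul]

/-- The image of the `j`-th unit vector under the linear part of `permMap σ`. -/
def permDir (σ : Equiv.Perm (Fin 3)) (j : Fin 2) : Fin 2 → ℝ := fun i => baryGrad (σ i.succ) j

theorem permMap_eq_add_smul_right (σ : Equiv.Perm (Fin 3)) (x y : ℝ) :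
    permMap σ ![x, y] = permMap σ ![x, 0] + y • permDir σ 1 := by
  have h := permMap_add_smul σ ![x, 0] ![0, 1] y
  have e : ![x, 0] + y • ![0, 1] = ![x, y] := by ext i; fin_cases i <;> simp
  rw [e] at h
  rw [h]
  congr 2
  ext i
  simp [permDir]

theorem permMap_eq_add_smul_left (σ : Equiv.Perm (Fin 3)) (x y : ℝ) :
    permMap σ ![x, y] = permMap σ ![0, y] + x • permDir σ 0 := by
  have h := permMap_add_smul σ ![0, y] ![1, 0] x
  have e : ![0, y] + x • ![1, 0] = ![x, y] := by ext i; fin_cases i <;> simp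
  rw [e] at h
  rw [h]
  congr 2
  ext i
  simp [permDir]

theorem continuous_integral_vec_right {f : (Fin 2 → ℝ) → ℝ} (hf : Continuous f) :
    Continuous fun x : ℝ => ∫ y in (0 : ℝ)..1 / 2, f ![x, y] := by
  refine intervalIntegral.continuous_parametric_intervalIntegral_of_continuous' ?_ 0 (1 / 2)
  have : Continuous fun z : ℝ × ℝ => ![z.1, z.2] := by fun_prop
  exact hf.comp this

theorem continuous_integral_vec_left {f : (Fin 2 → ℝ) → ℝ} (hf : Continuous f) :
    Continuous fun y : ℝ => ∫ x in (0 : ℝ)..1 / 2, f ![x, y] := by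
  refine intervalIntegral.continuous_parametric_intervalIntegral_of_continuous'
    (f := fun y x => f ![x, y]) ?_ 0 (1 / 2)
  have : Continuous fun z : ℝ × ℝ => ![z.2, z.1] := by fun_prop
  exact hf.comp this

theorem continuous_permMap_vec (σ : Equiv.Perm (Fin 3)) :
    Continuous fun x : ℝ => permMap σ ![x, 0] :=
  (continuous_permMap σ).comp (by fun_prop)

/-- The trace inequality on one half of an edge: each of its points is the end point of a segment in
the direction of another edge which sweeps out the image of `vertexSquare`. -/
theorem integral_half_edge_le {p : ℕ} (hp : 1 ≤ p) {u : MvPolynomial (Fin 2) ℝ}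
    (hu : u.totalDegree ≤ p) (σ : Equiv.Perm (Fin 3)) :
    ∫ x in (0 : ℝ)..1 / 2, MvPolynomial.eval (permMap σ ![x, 0]) u ^ 2 ≤
      8 * p ^ 2 * l2NormSq u := by
  have hc : Continuous fun x => MvPolynomial.eval (permMap σ x) u ^ 2 :=
    (continuous_eval_sq u).comp (continuous_permMap σ)
  have h := integral_vertexSquare_le (continuous_eval_sq u) (fun x => by positivity) σ
  rw [integral_vertexSquare hc] at h
  refine le_trans ?_ (mul_le_mul_of_nonneg_left h (by positivity))
  rw [← intervalIntegral.integral_const_mul]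
  refine intervalIntegral.integral_mono_on (by norm_num)
    (((continuous_eval_sq u).comp (continuous_permMap_vec σ)).intervalIntegrable _ _)
    (((continuous_integral_vec_right hc).const_mul _).intervalIntegrable _ _) fun x _ => ?_
  have h1 := eval_zero_sq_le_integral_half hp
    (natDegree_lineRestrict_le hu (permMap σ ![x, 0]) (permDir σ 1))
  simp only [eval_lineRestrict, ← permMap_eq_add_smul_right] at h1
  simpa using h1

theorem integral_vertexSquare_pderiv_sq_le {p : ℕ} {u : MvPolynomial (Fin 2) ℝ}
    (hu : u.totalDegree ≤ p) (σ : Equiv.Perm (Fin 3)) (j : Fin 2) :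
    ∫ x in vertexSquare,
        (∑ i, permDir σ j i * MvPolynomial.eval (permMap σ x) (MvPolynomial.pderiv i u)) ^ 2 ≤
      96 * p ^ 4 * l2NormSq u := by
  have hc : Continuous fun x => MvPolynomial.eval (permMap σ x) u ^ 2 :=
    (continuous_eval_sq u).comp (continuous_permMap σ)
  have hd : Continuous fun x => (∑ i, permDir σ j i *
      MvPolynomial.eval (permMap σ x) (MvPolynomial.pderiv i u)) ^ 2 :=
    (continuous_finsetSum _ fun i _ => ((MvPolynomial.continuous_eval _).comp
      (continuous_permMap σ)).const_mul _).pow 2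
  have h := integral_vertexSquare_le (continuous_eval_sq u) (fun x => by positivity) σ
  refine le_trans ?_ (mul_le_mul_of_nonneg_left h (by positivity))
  fin_cases j
  · rw [integral_vertexSquare_symm hd, integral_vertexSquare_symm hc,
      ← intervalIntegral.integral_const_mul]
    refine intervalIntegral.integral_mono_on (by norm_num)
      ((continuous_integral_vec_left hd).intervalIntegrable _ _)
      (((continuous_integral_vec_left hc).const_mul _).intervalIntegrable _ _) fun y _ => ?_
    have h1 := integral_half_derivative_sq_le
      (natDegree_lineRestrict_le hu (permMap σ ![0, y]) (permDir σ 0))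
    simp only [derivative_lineRestrict, Polynomial.eval_finsetSum, Polynomial.eval_C_mul,
      eval_lineRestrict, ← permMap_eq_add_smul_left] at h1
    exact h1
  · rw [integral_vertexSquare hd, integral_vertexSquare hc,
      ← intervalIntegral.integral_const_mul]
    refine intervalIntegral.integral_mono_on (by norm_num)
      ((continuous_integral_vec_right hd).intervalIntegrable _ _)
      (((continuous_integral_vec_right hc).const_mul _).intervalIntegrable _ _) fun x _ => ?_
    have h1 := integral_half_derivative_sq_le
      (natDegree_lineRestrict_le hu (permMap σ ![x, 0]) (permDir σ 1))
    simp only [derivative_lineRestrict, Polynomial.eval_finsetSum, Polynomial.eval_C_mul,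
      eval_lineRestrict, ← permMap_eq_add_smul_right] at h1
    exact h1

/-- The matrix of two of the gradients of the barycentric coordinates has an inverse whose entries
are at most one in absolute value. -/
theorem sq_le_sum_baryGrad {a b : Fin 3} (h : a ≠ b) (g : Fin 2 → ℝ) (i : Fin 2) :
    g i ^ 2 ≤ 2 * ∑ j, (baryGrad a j * g 0 + baryGrad b j * g 1) ^ 2 := by
  have h1 := sq_nonneg (g 0)
  have h2 := sq_nonneg (g 1)
  have h3 := sq_nonneg (g 0 + g 1)
  have h4 := sq_nonneg (g 0 - g 1)
  have h5 := sq_nonneg (2 * g 0 - g 1)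
  have h6 := sq_nonneg (g 0 - 2 * g 1)
  fin_cases a <;> fin_cases b <;> fin_cases i <;> simp [baryGrad] at h ⊢ <;> nlinarith

/-- The Markov inequality on the triangle: every point lies in one of the parallelograms that are
the images of `vertexSquare`, and these are made of segments of a fixed length. -/
theorem l2NormSq_pderiv_le {p : ℕ} {u : MvPolynomial (Fin 2) ℝ} (hu : u.totalDegree ≤ p)
    (i : Fin 2) : l2NormSq (MvPolynomial.pderiv i u) ≤ 2304 * p ^ 4 * l2NormSq u := by
  have h1 := integral_refTriangle_le_sum (continuous_eval_sq (MvPolynomial.pderiv i u))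
    fun x => by positivity
  refine h1.trans ?_
  have hint (σ : Equiv.Perm (Fin 3)) (j : Fin 2) : MeasureTheory.IntegrableOn (fun x =>
      (∑ i, permDir σ j i * MvPolynomial.eval (permMap σ x) (MvPolynomial.pderiv i u)) ^ 2)
      vertexSquare :=
    (integrableOn_refTriangle ((continuous_finsetSum _ fun i _ =>
      ((MvPolynomial.continuous_eval _).comp
      (continuous_permMap σ)).const_mul _).pow 2)).mono_set vertexSquare_subset
  have h2 (σ : Equiv.Perm (Fin 3)) :
      ∫ x in vertexSquare, MvPolynomial.eval (permMap σ x) (MvPolynomial.pderiv i u) ^ 2 ≤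
        384 * p ^ 4 * l2NormSq u := by
    calc ∫ x in vertexSquare, MvPolynomial.eval (permMap σ x) (MvPolynomial.pderiv i u) ^ 2
        ≤ ∫ x in vertexSquare, 2 * ∑ j, (∑ i, permDir σ j i *
            MvPolynomial.eval (permMap σ x) (MvPolynomial.pderiv i u)) ^ 2 := by
          refine MeasureTheory.integral_mono
            ((integrableOn_refTriangle ((continuous_eval_sq _).comp
              (continuous_permMap σ))).mono_set vertexSquare_subset)
            ((MeasureTheory.integrable_finsetSum _ fun j _ => hint σ j).const_mul 2) fun x => ?_
          have h := sq_le_sum_baryGrad (a := σ 1) (b := σ 2) (by simp)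
            (fun i => MvPolynomial.eval (permMap σ x) (MvPolynomial.pderiv i u)) i
          simpa [permDir, Fin.sum_univ_two] using h
      _ = 2 * ∑ j, ∫ x in vertexSquare, (∑ i, permDir σ j i *
            MvPolynomial.eval (permMap σ x) (MvPolynomial.pderiv i u)) ^ 2 := by
          rw [MeasureTheory.integral_const_mul, MeasureTheory.integral_finsetSum _
            fun j _ => hint σ j]
      _ ≤ 2 * ∑ _j : Fin 2, 96 * p ^ 4 * l2NormSq u := by
          gcongr with j
          exact integral_vertexSquare_pderiv_sq_le hu σ j
      _ = 384 * p ^ 4 * l2NormSq u := by simp; ring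
  refine (Finset.sum_le_sum fun σ _ => h2 σ).trans (le_of_eq ?_)
  rw [Finset.sum_const, Finset.card_univ, Fintype.card_perm, Fintype.card_fin]
  norm_num [Nat.factorial]
  ring

/-! ### Traces on the edges -/

/-- The vertices of the reference triangle. -/
def vertex : Fin 3 → Fin 2 → ℝ := ![![0, 0], ![1, 0], ![0, 1]]

theorem baryAt_vertex (a k : Fin 3) : baryAt (vertex a) k = if k = a then 1 else 0 := by
  fin_cases a <;> fin_cases k <;> simp [baryAt, vertex]

/-- The trace of a polynomial on the edge from the vertex `a` to the vertex `b`, which is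
parametrized by `[-1, 1]`. -/
noncomputable def edgeTrace (a b : Fin 3) (u : MvPolynomial (Fin 2) ℝ) : Polynomial ℝ :=
  lineRestrict u ((1 / 2 : ℝ) • (vertex a + vertex b)) ((1 / 2 : ℝ) • (vertex b - vertex a))

/-- The point of the edge from the vertex `a` to the vertex `b` with parameter `s ∈ [-1, 1]`. -/
noncomputable def edgePoint (a b : Fin 3) (s : ℝ) : Fin 2 → ℝ :=
  (1 / 2 : ℝ) • (vertex a + vertex b) + s • (1 / 2 : ℝ) • (vertex b - vertex a)

theorem eval_edgeTrace (a b : Fin 3) (u : MvPolynomial (Fin 2) ℝ) (s : ℝ) :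
    (edgeTrace a b u).eval s = MvPolynomial.eval (edgePoint a b s) u :=
  eval_lineRestrict _ _ _ _

theorem natDegree_edgeTrace_le {p : ℕ} {u : MvPolynomial (Fin 2) ℝ} (hu : u.totalDegree ≤ p)
    (a b : Fin 3) : (edgeTrace a b u).natDegree ≤ p :=
  natDegree_lineRestrict_le hu _ _

theorem edgePoint_one (a b : Fin 3) : edgePoint a b 1 = vertex b := by
  ext i
  simp [edgePoint]
  ring

theorem edgePoint_neg (a b : Fin 3) (s : ℝ) : edgePoint a b (-s) = edgePoint b a s := by
  ext i
  simp [edgePoint]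
  ring

theorem baryAt_edgePoint (a b k : Fin 3) (s : ℝ) :
    baryAt (edgePoint a b s) k =
      (if k = a then (1 - s) / 2 else 0) + if k = b then (1 + s) / 2 else 0 := by
  fin_cases a <;> fin_cases b <;> fin_cases k <;> simp [baryAt, vertex, edgePoint] <;> ring

theorem integral_edgeTrace_half_le {p : ℕ} (hp : 1 ≤ p) {u : MvPolynomial (Fin 2) ℝ}
    (hu : u.totalDegree ≤ p) {a b : Fin 3} (hab : a ≠ b) :
    ∫ s in (-1 : ℝ)..0, (edgeTrace a b u).eval s ^ 2 ≤ 16 * p ^ 2 * l2NormSq u := by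
  obtain ⟨σ, h0, h1⟩ : ∃ σ : Equiv.Perm (Fin 3), σ a = 0 ∧ σ b = 1 := by
    revert a b; decide
  have h := integral_half_edge_le hp hu σ
  have hpt (x : ℝ) : permMap σ ![x, 0] = edgePoint a b (2 * x + -1) := by
    refine ext_baryAt fun k => ?_
    rw [baryAt_permMap, baryAt_edgePoint]
    have h2 : k ≠ a → k ≠ b → σ k = 2 := by
      intro hka hkb
      have e0 : σ k ≠ 0 := fun h => hka (σ.injective (h.trans h0.symm))
      have e1 : σ k ≠ 1 := fun h => hkb (σ.injective (h.trans h1.symm))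
      generalize σ k = m at e0 e1
      revert m; decide
    by_cases hka : k = a
    · subst hka
      simp [h0, baryAt, hab]
      ring
    · by_cases hkb : k = b
      · subst hkb
        simp [h1, baryAt, hab.symm]
      · simp [hka, hkb, h2 hka hkb, baryAt]
  have hsub := intervalIntegral.mul_integral_comp_mul_add (a := 0) (b := 1 / 2)
    (f := fun s => (edgeTrace a b u).eval s ^ 2) (c := 2) (d := -1)
  norm_num at hsub
  simp only [hpt, ← eval_edgeTrace] at h
  norm_num at h
  rw [← hsub]
  linarith

/-- The discrete trace inequality on the edges. -/
theorem integral_edgeTrace_sq_le {p : ℕ} (hp : 1 ≤ p) {u : MvPolynomial (Fin 2) ℝ}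
    (hu : u.totalDegree ≤ p) {a b : Fin 3} (hab : a ≠ b) :
    ∫ s in (-1 : ℝ)..1, (edgeTrace a b u).eval s ^ 2 ≤ 32 * p ^ 2 * l2NormSq u := by
  have h1 := integral_edgeTrace_half_le hp hu hab
  have h2 := integral_edgeTrace_half_le hp hu hab.symm
  have h3 := intervalIntegral.integral_comp_neg (a := -1) (b := 0)
    fun s => (edgeTrace a b u).eval s ^ 2
  simp only [eval_edgeTrace, edgePoint_neg, neg_zero, neg_neg] at h1 h2 h3 ⊢
  rw [← intervalIntegral.integral_add_adjacent_intervals (b := 0), ← h3]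
  · linarith
  all_goals
    simp only [← eval_edgeTrace]
    exact (by fun_prop : Continuous _).intervalIntegrable _ _

theorem derivative_edgeTrace (a b : Fin 3) (u : MvPolynomial (Fin 2) ℝ) (s : ℝ) :
    (Polynomial.derivative (edgeTrace a b u)).eval s = ∑ i, (vertex b i - vertex a i) / 2 *
      (edgeTrace a b (MvPolynomial.pderiv i u)).eval s := by
  simp only [edgeTrace, derivative_lineRestrict, Polynomial.eval_finsetSum, Polynomial.eval_C_mul]
  refine Finset.sum_congr rfl fun i _ => ?_
  simp
  left; ring

theorem abs_vertex_sub_le (a b : Fin 3) (i : Fin 2) : |vertex b i - vertex a i| ≤ 1 := by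
  fin_cases a <;> fin_cases b <;> fin_cases i <;> simp [vertex]

theorem totalDegree_pderiv_le (i : Fin 2) (u : MvPolynomial (Fin 2) ℝ) :
    (MvPolynomial.pderiv i u).totalDegree ≤ u.totalDegree := by
  conv_lhs => rw [u.as_sum, map_sum]
  refine MvPolynomial.totalDegree_finsetSum_le fun s hs => ?_
  rw [MvPolynomial.pderiv_monomial]
  refine (MvPolynomial.totalDegree_monomial_le _ _).trans
    (le_trans ?_ (MvPolynomial.le_totalDegree hs))
  rw [Finsupp.sum_fintype _ _ (by simp), Finsupp.sum_fintype _ _ (by simp)]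
  exact Finset.sum_le_sum fun j _ => by simp

theorem integral_derivative_edgeTrace_sq_le {p : ℕ} (hp : 1 ≤ p) {u : MvPolynomial (Fin 2) ℝ}
    (hu : u.totalDegree ≤ p) {a b : Fin 3} (hab : a ≠ b) :
    ∫ s in (-1 : ℝ)..1, (Polynomial.derivative (edgeTrace a b u)).eval s ^ 2 ≤
      16 * p ^ 2 * ∑ i, l2NormSq (MvPolynomial.pderiv i u) := by
  have hd (i : Fin 2) : (MvPolynomial.pderiv i u).totalDegree ≤ p :=
    (totalDegree_pderiv_le i u).trans hu
  have hle (i : Fin 2) := integral_edgeTrace_sq_le hp (hd i) hab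
  calc ∫ s in (-1 : ℝ)..1, (Polynomial.derivative (edgeTrace a b u)).eval s ^ 2
      ≤ ∫ s in (-1 : ℝ)..1, 1 / 2 * ∑ i,
          (edgeTrace a b (MvPolynomial.pderiv i u)).eval s ^ 2 := by
        refine intervalIntegral.integral_mono_on (by norm_num)
          ((by fun_prop : Continuous _).intervalIntegrable _ _)
          ((by fun_prop : Continuous _).intervalIntegrable _ _) fun s _ => ?_
        rw [derivative_edgeTrace, Fin.sum_univ_two, Fin.sum_univ_two]
        have key : ∀ c d x y : ℝ, |c| ≤ 1 → |d| ≤ 1 →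
            (c / 2 * x + d / 2 * y) ^ 2 ≤ 1 / 2 * (x ^ 2 + y ^ 2) := by
          intro c d x y hc hd
          have hc2 : c ^ 2 ≤ 1 := (sq_le_one_iff_abs_le_one c).mpr hc
          have hd2 : d ^ 2 ≤ 1 := (sq_le_one_iff_abs_le_one d).mpr hd
          nlinarith [sq_nonneg (c * x - d * y), mul_nonneg (sub_nonneg.mpr hc2) (sq_nonneg x),
            mul_nonneg (sub_nonneg.mpr hd2) (sq_nonneg y)]
        exact key _ _ _ _ (abs_vertex_sub_le a b 0) (abs_vertex_sub_le a b 1)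
    _ = 1 / 2 * ∑ i, ∫ s in (-1 : ℝ)..1,
          (edgeTrace a b (MvPolynomial.pderiv i u)).eval s ^ 2 := by
        rw [intervalIntegral.integral_const_mul, intervalIntegral.integral_finsetSum fun i _ =>
          (by fun_prop : Continuous _).intervalIntegrable _ _]
    _ ≤ 1 / 2 * ∑ i, 32 * p ^ 2 * l2NormSq (MvPolynomial.pderiv i u) := by
        gcongr with i
        exact hle i
    _ = 16 * p ^ 2 * ∑ i, l2NormSq (MvPolynomial.pderiv i u) := by
        rw [← Finset.mul_sum]; ring

/-! ### Edge functions -/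

open Polynomial in
theorem derivative_intLegendrePoly {n : ℕ} (hn : 1 ≤ n) :
    derivative (intLegendrePoly n) = legendrePoly (n - 1) := by
  have hdeg : (legendrePoly (n - 1)).natDegree < n := by
    rw [natDegree_legendrePoly]; omega
  conv_rhs => rw [(legendrePoly (n - 1)).as_sum_range' n hdeg]
  rw [intLegendrePoly, derivative_sum]
  refine Finset.sum_congr rfl fun k _ => ?_
  have hk : (k + 1 : ℝ) ≠ 0 := by positivity
  rw [derivative_C_mul, derivative_sub, derivative_C, sub_zero, derivative_X_pow,
    ← C_mul_X_pow_eq_monomial, ← mul_assoc, ← C_mul]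
  push_cast
  rw [div_mul_cancel₀ _ hk]

theorem eval_neg_one_intLegendrePoly (n : ℕ) : (intLegendrePoly n).eval (-1) = 0 := by
  rw [intLegendrePoly, Polynomial.eval_finsetSum]
  exact Finset.sum_eq_zero fun k _ => by simp

theorem eval_one_intLegendrePoly {n : ℕ} (hn : 2 ≤ n) : (intLegendrePoly n).eval 1 = 0 := by
  have h1 := integral_eval_derivative (intLegendrePoly n) (-1) 1
  have h2 := integral_legendrePoly_mul_eq_zero (n - 1) (q := 1)
    (by rw [Polynomial.degree_one]; exact_mod_cast (by omega : 0 < n - 1))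
  rw [derivative_intLegendrePoly (by omega), eval_neg_one_intLegendrePoly, sub_zero] at h1
  rw [← h1]
  simpa using h2

/-- The polynomial `∑ a_i √((2i+3)/2) L_{i+2}`: the trace on its own edge of a combination of the
edge functions of one edge. -/
noncomputable def edgeBubble (N : ℕ) (a : ℕ → ℝ) : Polynomial ℝ :=
  ∑ i ∈ Finset.range N, Polynomial.C (a i * Real.sqrt ((2 * i + 3) / 2)) * intLegendrePoly (i + 2)

theorem eval_edgeBubble (N : ℕ) (a : ℕ → ℝ) (s : ℝ) : (edgeBubble N a).eval s =
    ∑ i ∈ Finset.range N, a i * Real.sqrt ((2 * i + 3) / 2) * (intLegendrePoly (i + 2)).eval s := by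
  simp [edgeBubble, Polynomial.eval_finsetSum]

theorem eval_derivative_edgeBubble (N : ℕ) (a : ℕ → ℝ) (s : ℝ) :
    (Polynomial.derivative (edgeBubble N a)).eval s =
    ∑ i ∈ Finset.range N, a i * Real.sqrt ((2 * i + 3) / 2) * (legendrePoly (i + 1)).eval s := by
  rw [edgeBubble, Polynomial.derivative_sum, Polynomial.eval_finsetSum]
  refine Finset.sum_congr rfl fun i _ => ?_
  rw [Polynomial.derivative_C_mul, derivative_intLegendrePoly (by omega), Polynomial.eval_C_mul]
  rfl

/-- The functions `√((2i+3)/2) L_{i+2}` are orthonormal in `H¹₀(-1, 1)`, and their derivatives are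
orthogonal to the constants. -/
theorem integral_const_add_derivative_edgeBubble_sq (N : ℕ) (a : ℕ → ℝ) (c : ℝ) :
    ∫ s in (-1 : ℝ)..1, (c + (Polynomial.derivative (edgeBubble N a)).eval s) ^ 2 =
      2 * c ^ 2 + ∑ i ∈ Finset.range N, a i ^ 2 := by
  have h := integral_sum_legendrePoly_sq (Finset.range (N + 1))
    fun n => Nat.casesOn n c fun i => a i * Real.sqrt ((2 * i + 3) / 2)
  have h0 (s : ℝ) : (legendrePoly 0).eval s = 1 := by simp [legendrePoly, jacobiPoly]
  simp only [Finset.sum_range_succ', h0, mul_one] at h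
  simp only [eval_derivative_edgeBubble, add_comm c]
  refine h.trans ?_
  have e (i : ℕ) : (a i * Real.sqrt ((2 * i + 3) / 2)) ^ 2 * (2 / (2 * ((i + 1 : ℕ) : ℝ) + 1)) =
      a i ^ 2 := by
    rw [mul_pow, Real.sq_sqrt (by positivity)]
    push_cast
    have : (2 * i + 3 : ℝ) ≠ 0 := by positivity
    have e1 : (2 * (i + 1) + 1 : ℝ) = 2 * i + 3 := by ring
    rw [e1]
    field_simp
  simp only [e]
  norm_num
  ring

theorem integral_edgeBubble_sq_le (N : ℕ) (a : ℕ → ℝ) :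
    ∫ s in (-1 : ℝ)..1, (edgeBubble N a).eval s ^ 2 ≤ 4 * ∑ i ∈ Finset.range N, a i ^ 2 := by
  have h := integral_const_add_derivative_edgeBubble_sq N a 0
  simp only [zero_add, zero_pow two_ne_zero, mul_zero] at h
  rw [← h]
  refine integral_sq_le_of_eval_eq_zero ?_ ?_
  · rw [eval_edgeBubble]
    exact Finset.sum_eq_zero fun i _ => by rw [eval_one_intLegendrePoly (by omega), mul_zero]
  · rw [eval_edgeBubble]
    exact Finset.sum_eq_zero fun i _ => by rw [eval_neg_one_intLegendrePoly, mul_zero]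

theorem scaledPoly_eq_sum (n : ℕ) (P : Polynomial ℝ) (S T : MvPolynomial (Fin 2) ℝ) :
    scaledPoly n P S T = ∑ k ∈ Finset.range (n + 1),
      MvPolynomial.C (P.coeff k) * (S ^ k * T ^ (n - k)) := by
  rw [scaledPoly, Polynomial.homogenize, map_sum, Finset.Nat.sum_antidiagonal_eq_sum_range_succ_mk]
  refine Finset.sum_congr rfl fun k _ => ?_
  rw [MvPolynomial.aeval_monomial, Finsupp.prod_fintype _ _ (by simp), Fin.prod_univ_two]
  simp [MvPolynomial.algebraMap_eq]

/-- The value `T ^ n * P (S / T)` of the scaled polynomial, in a form that also holds for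
`T = 0`. -/
theorem eval_scaledPoly_of_eq_mul {n : ℕ} {P : Polynomial ℝ} (hP : P.natDegree ≤ n)
    {S T : MvPolynomial (Fin 2) ℝ} {x : Fin 2 → ℝ} {s : ℝ}
    (h : MvPolynomial.eval x S = s * MvPolynomial.eval x T) :
    MvPolynomial.eval x (scaledPoly n P S T) = MvPolynomial.eval x T ^ n * P.eval s := by
  rw [scaledPoly_eq_sum, map_sum, P.eval_eq_sum_range' (Nat.lt_succ_of_le hP), Finset.mul_sum]
  refine Finset.sum_congr rfl fun k hk => ?_
  have hk' : k ≤ n := Nat.lt_succ_iff.mp (Finset.mem_range.mp hk)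
  simp only [map_mul, map_pow, MvPolynomial.eval_C, h]
  have e : MvPolynomial.eval x T ^ n =
      MvPolynomial.eval x T ^ k * MvPolynomial.eval x T ^ (n - k) := by
    rw [← pow_add, Nat.add_sub_cancel' hk']
  rw [e]
  ring

theorem totalDegree_scaledPoly_le (n : ℕ) (P : Polynomial ℝ) {S T : MvPolynomial (Fin 2) ℝ}
    (hS : S.totalDegree ≤ 1) (hT : T.totalDegree ≤ 1) : (scaledPoly n P S T).totalDegree ≤ n := by
  rw [scaledPoly_eq_sum]
  refine MvPolynomial.totalDegree_finsetSum_le fun k hk => ?_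
  have hk' : k ≤ n := Nat.lt_succ_iff.mp (Finset.mem_range.mp hk)
  refine (MvPolynomial.totalDegree_mul _ _).trans ?_
  rw [MvPolynomial.totalDegree_C, zero_add]
  refine (MvPolynomial.totalDegree_mul _ _).trans ?_
  have h1 := (MvPolynomial.totalDegree_pow S k).trans (Nat.mul_le_mul_left k hS)
  have h2 := (MvPolynomial.totalDegree_pow T (n - k)).trans (Nat.mul_le_mul_left (n - k) hT)
  omega

theorem eval_edgeFun {e₁ e₂ : Fin 3} {i : ℕ} {x : Fin 2 → ℝ} {s : ℝ}
    (h : baryAt x e₂ - baryAt x e₁ = s * (baryAt x e₁ + baryAt x e₂)) :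
    MvPolynomial.eval x (edgeFun e₁ e₂ i) = Real.sqrt ((2 * i + 3) / 2) *
      ((baryAt x e₁ + baryAt x e₂) ^ (i + 2) * (intLegendrePoly (i + 2)).eval s) := by
  rw [edgeFun, map_mul, MvPolynomial.eval_C,
    eval_scaledPoly_of_eq_mul (natDegree_intLegendrePoly_le _) (s := s)]
  · simp [eval_bary]
  · simpa [eval_bary] using h

/-- The edge functions vanish on the other two edges. -/
theorem eval_edgeFun_eq_zero {e₁ e₂ : Fin 3} (i : ℕ) {x : Fin 2 → ℝ}
    (h : baryAt x e₁ = 0 ∨ baryAt x e₂ = 0) : MvPolynomial.eval x (edgeFun e₁ e₂ i) = 0 := by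
  rcases h with h | h
  · rw [eval_edgeFun (s := 1) (by rw [h]; ring), eval_one_intLegendrePoly (by omega)]
    ring
  · rw [eval_edgeFun (s := -1) (by rw [h]; ring), eval_neg_one_intLegendrePoly]
    ring

theorem eval_edgePoint_edgeFun {a b : Fin 3} (hab : a ≠ b) (i : ℕ) (s : ℝ) :
    MvPolynomial.eval (edgePoint a b s) (edgeFun a b i) =
      Real.sqrt ((2 * i + 3) / 2) * (intLegendrePoly (i + 2)).eval s := by
  have ha : baryAt (edgePoint a b s) a = (1 - s) / 2 := by simp [baryAt_edgePoint, hab]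
  have hb : baryAt (edgePoint a b s) b = (1 + s) / 2 := by simp [baryAt_edgePoint, hab.symm]
  rw [eval_edgeFun (s := s) (by rw [ha, hb]; ring), ha, hb]
  have : (1 - s) / 2 + (1 + s) / 2 = 1 := by ring
  rw [this, one_pow, one_mul]

theorem continuous_integral_duffy {f : (Fin 2 → ℝ) → ℝ} (hf : Continuous f) :
    Continuous fun t : ℝ => ∫ s in (-1 : ℝ)..1, f (duffy t s) := by
  refine intervalIntegral.continuous_parametric_intervalIntegral_of_continuous'
    (f := fun t s => f (duffy t s)) ?_ (-1) 1
  have : Continuous fun z : ℝ × ℝ => duffy z.1 z.2 := by unfold duffy; fun_prop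
  exact hf.comp this

/-- The `L²` stability of the edge functions of one edge: in coordinates that collapse the triangle
to the opposite vertex, this is the Poincaré inequality on each segment parallel to the edge. -/
theorem l2NormSq_sum_edgeFun_le {e₁ e₂ : Fin 3} (he : e₁ ≠ e₂) (N : ℕ) (a : ℕ → ℝ) :
    l2NormSq (∑ i ∈ Finset.range N, a i • edgeFun e₁ e₂ i) ≤
      2 * ∑ i ∈ Finset.range N, a i ^ 2 := by
  obtain ⟨σ, h1, h2⟩ : ∃ σ : Equiv.Perm (Fin 3), σ e₁ = 1 ∧ σ e₂ = 0 := by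
    revert e₁ e₂; decide
  set u := ∑ i ∈ Finset.range N, a i • edgeFun e₁ e₂ i with hu
  have hc : Continuous fun x => MvPolynomial.eval (permMap σ x) u ^ 2 :=
    (continuous_eval_sq u).comp (continuous_permMap σ)
  -- `permMap σ` moves the edge to the one opposite to the third vertex, where `duffy` collapses
  have heval (t s : ℝ) : MvPolynomial.eval (permMap σ (duffy t s)) u =
      (edgeBubble N fun i => a i * t ^ (i + 2)).eval s := by
    have b1 : baryAt (permMap σ (duffy t s)) e₁ = t * (1 - s) / 2 := by
      simp [baryAt_permMap, h1, baryAt_duffy]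
    have b2 : baryAt (permMap σ (duffy t s)) e₂ = t * (1 + s) / 2 := by
      simp [baryAt_permMap, h2, baryAt_duffy]
    rw [eval_edgeBubble, hu, map_sum]
    refine Finset.sum_congr rfl fun i _ => ?_
    rw [MvPolynomial.smul_eval, eval_edgeFun (s := s) (by rw [b1, b2]; ring), b1, b2]
    have : t * (1 - s) / 2 + t * (1 + s) / 2 = t := by ring
    rw [this]
    ring
  rw [l2NormSq, ← integral_permMap σ, integral_refTriangle_duffy hc]
  have hle : ∫ t in (0 : ℝ)..1, t / 2 * ∫ s in (-1 : ℝ)..1,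
      MvPolynomial.eval (permMap σ (duffy t s)) u ^ 2 ≤
      ∫ _t in (0 : ℝ)..1, 2 * ∑ i ∈ Finset.range N, a i ^ 2 := by
    refine intervalIntegral.integral_mono_on zero_le_one
      (((continuous_id.div_const 2).mul (continuous_integral_duffy hc)).intervalIntegrable _ _)
      intervalIntegrable_const fun t ht => ?_
    simp only [heval]
    have h3 := integral_edgeBubble_sq_le N fun i => a i * t ^ (i + 2)
    have h4 : ∑ i ∈ Finset.range N, (a i * t ^ (i + 2)) ^ 2 ≤ ∑ i ∈ Finset.range N, a i ^ 2 := by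
      refine Finset.sum_le_sum fun i _ => ?_
      rw [mul_pow]
      have : (t ^ (i + 2)) ^ 2 ≤ 1 :=
        pow_le_one₀ (pow_nonneg ht.1 _) (pow_le_one₀ ht.1 ht.2)
      nlinarith [sq_nonneg (a i)]
    have h5 : 0 ≤ ∑ i ∈ Finset.range N, a i ^ 2 := Finset.sum_nonneg fun i _ => by positivity
    calc t / 2 * _ ≤ t / 2 * (4 * ∑ i ∈ Finset.range N, a i ^ 2) :=
          mul_le_mul_of_nonneg_left (by linarith) (by linarith [ht.1])
      _ ≤ 2 * ∑ i ∈ Finset.range N, a i ^ 2 := by nlinarith [ht.2]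
  refine hle.trans (le_of_eq ?_)
  simp

/-! ### Cell functions -/

/-- In the collapsed coordinates the cell functions are products. -/
theorem eval_duffy_cellFunRaw (i j : ℕ) (t s : ℝ) :
    MvPolynomial.eval (duffy t s) (cellFunRaw i j) =
      t ^ (i + 2) * (1 - t) * (jacobiPoly (2 * i + 5) 2 j).eval (1 - 2 * t) *
        ((1 - s ^ 2) / 4 * (jacobiPoly 2 2 i).eval s) := by
  have e : MvPolynomial.eval (duffy t s)
      (Polynomial.aeval (2 * bary 2 - 1) (jacobiPoly (2 * i + 5) 2 j)) =
      (jacobiPoly (2 * i + 5) 2 j).eval (1 - 2 * t) := by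
    have hid : (MvPolynomial.eval (duffy t s)).comp (algebraMap ℝ (MvPolynomial (Fin 2) ℝ)) =
        RingHom.id ℝ := RingHom.ext fun r => by simp [MvPolynomial.algebraMap_eq]
    rw [Polynomial.aeval_def, Polynomial.hom_eval₂, hid, ← Polynomial.eval]
    congr 1
    rw [map_sub, map_mul, eval_bary, baryAt_duffy]
    simp
    ring
  have hT : MvPolynomial.eval (duffy t s) (bary 0 + bary 1) = t := by
    rw [map_add, eval_bary, eval_bary, baryAt_duffy]
    simp
    ring
  rw [cellFunRaw, map_mul, map_mul, e, eval_scaledPoly_of_eq_mul (natDegree_jacobiPoly_le _ _ _)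
    (s := s), hT]
  · simp only [map_mul, eval_bary, baryAt_duffy]
    simp
    ring
  · rw [hT, map_sub, eval_bary, eval_bary, baryAt_duffy]
    simp
    ring

/-- The substitution `w = 1 - 2 t`, which turns the weight `t ^ m * (1 - t) ^ 2` on `[0, 1]` into a
Jacobi weight. -/
theorem integral_pow_mul_eval_one_sub_two_mul (m : ℕ) (q : Polynomial ℝ) :
    ∫ t in (0 : ℝ)..1, t ^ m * (1 - t) ^ 2 * q.eval (1 - 2 * t) =
      (-1) ^ m / 2 ^ (m + 3) * ∫ w in (-1 : ℝ)..1,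
        ((Polynomial.X - 1) ^ m * (Polynomial.X + 1) ^ 2 * q).eval w := by
  have h := intervalIntegral.mul_integral_comp_mul_add (a := 0) (b := 1)
    (f := fun w => ((Polynomial.X - 1) ^ m * (Polynomial.X + 1) ^ 2 * q).eval w) (c := -2) (d := 1)
  have e (t : ℝ) : ((Polynomial.X - 1) ^ m * (Polynomial.X + 1) ^ 2 * q).eval (-2 * t + 1) =
      (-1) ^ m * 2 ^ (m + 2) * (t ^ m * (1 - t) ^ 2 * q.eval (1 - 2 * t)) := by
    have e1 : -2 * t + 1 = 1 - 2 * t := by ring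
    have e2 : (1 - 2 * t - 1) ^ m = (-1) ^ m * 2 ^ m * t ^ m := by
      rw [← mul_pow, ← mul_pow]; congr 1; ring
    have e3 : (1 - 2 * t + 1) ^ 2 = 2 ^ 2 * (1 - t) ^ 2 := by ring
    simp only [e1, Polynomial.eval_mul, Polynomial.eval_pow, Polynomial.eval_sub,
      Polynomial.eval_add, Polynomial.eval_X, Polynomial.eval_one, e2, e3]
    ring
  simp only [e, intervalIntegral.integral_const_mul] at h
  have l1 : (-2 * 0 + 1 : ℝ) = 1 := by norm_num
  have l2 : (-2 * 1 + 1 : ℝ) = -1 := by norm_num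
  rw [l1, l2, intervalIntegral.integral_symm (-1) 1] at h
  have hs : ((-1 : ℝ) ^ m) ^ 2 = 1 := by rw [← pow_mul, mul_comm, pow_mul]; simp
  rw [← neg_eq_iff_eq_neg.mpr h, pow_succ _ (m + 2)]
  generalize ∫ t in (0 : ℝ)..1, t ^ m * (1 - t) ^ 2 * q.eval (1 - 2 * t) = J
  field_simp
  linear_combination -J * hs

theorem integral_cellFunRaw_mul (i j k l : ℕ) :
    ∫ x in refTriangle,
        MvPolynomial.eval x (cellFunRaw i j) * MvPolynomial.eval x (cellFunRaw k l) =
      (∫ t in (0 : ℝ)..1, t ^ (i + k + 5) * (1 - t) ^ 2 *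
        (jacobiPoly (2 * i + 5) 2 j * jacobiPoly (2 * k + 5) 2 l).eval (1 - 2 * t)) *
      (1 / 32 * ∫ s in (-1 : ℝ)..1, ((Polynomial.X - 1) ^ 2 * (Polynomial.X + 1) ^ 2 *
        jacobiPoly 2 2 i * jacobiPoly 2 2 k).eval s) := by
  have hc : Continuous fun x => MvPolynomial.eval x (cellFunRaw i j) *
      MvPolynomial.eval x (cellFunRaw k l) :=
    (MvPolynomial.continuous_eval _).mul (MvPolynomial.continuous_eval _)
  rw [integral_refTriangle_duffy hc, ← intervalIntegral.integral_mul_const]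
  refine intervalIntegral.integral_congr fun t _ => ?_
  simp only [eval_duffy_cellFunRaw]
  rw [← intervalIntegral.integral_const_mul, ← intervalIntegral.integral_const_mul,
    ← intervalIntegral.integral_const_mul]
  refine intervalIntegral.integral_congr fun s _ => ?_
  simp only [Polynomial.eval_mul, Polynomial.eval_pow, Polynomial.eval_sub, Polynomial.eval_add,
    Polynomial.eval_X, Polynomial.eval_one]
  ring

/-- The product of two cell functions separates. For `i ≠ k` the integral in `s` vanishes;
for `i = k` the powers of `t` combine to the weight to which the second Jacobi polynomials are orthogonal. -/
theorem integral_cellFunRaw_mul_eq_zero {i j k l : ℕ} (h : i ≠ k ∨ j ≠ l) :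
    ∫ x in refTriangle,
      MvPolynomial.eval x (cellFunRaw i j) * MvPolynomial.eval x (cellFunRaw k l) = 0 := by
  rw [integral_cellFunRaw_mul]
  by_cases hik : i = k
  · subst hik
    have hj := h.resolve_left (by simp)
    have e : i + i + 5 = 2 * i + 5 := by ring
    rw [e, integral_pow_mul_eval_one_sub_two_mul, ← mul_assoc (_ * _ : Polynomial ℝ),
      integral_jacobiPoly_mul_jacobiPoly _ _ hj]
    simp
  · rw [integral_jacobiPoly_mul_jacobiPoly _ _ hik]
    simp

theorem l2NormSq_cellFunRaw_pos (i j : ℕ) : 0 < l2NormSq (cellFunRaw i j) := by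
  have h := integral_cellFunRaw_mul i j i j
  simp only [← sq] at h
  rw [l2NormSq, h]
  -- `(w - 1) ^ (2 i + 5)` is negative on `(-1, 1)`; the sign from the substitution compensates this
  have hX1 : (Polynomial.X - 1 : Polynomial ℝ) ≠ 0 := by
    simpa using Polynomial.X_sub_C_ne_zero (1 : ℝ)
  have hX2 : (Polynomial.X + 1 : Polynomial ℝ) ≠ 0 := by
    simpa using Polynomial.X_add_C_ne_zero (1 : ℝ)
  refine mul_pos ?_ (mul_pos (by norm_num) ?_)
  · have e : i + i + 5 = 2 * i + 5 := by ring
    have hm : ((-1 : ℝ)) ^ (2 * i + 5) = -1 := by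
      rw [pow_add, pow_mul]; norm_num
    rw [e, integral_pow_mul_eval_one_sub_two_mul, hm]
    have := integral_eval_pos (q := -((Polynomial.X - 1) ^ (2 * i + 5) * (Polynomial.X + 1) ^ 2 *
      jacobiPoly (2 * i + 5) 2 j ^ 2)) (neg_ne_zero.mpr (mul_ne_zero (mul_ne_zero
      (pow_ne_zero _ hX1) (pow_ne_zero _ hX2)) (pow_ne_zero _ (jacobiPoly_ne_zero _ _ _))))
      (a := -1) (b := 1) (by norm_num) fun x hx => by
        simp only [Polynomial.eval_neg, Polynomial.eval_mul, Polynomial.eval_pow,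
          Polynomial.eval_sub, Polynomial.eval_add, Polynomial.eval_X, Polynomial.eval_one]
        have hodd : (x - 1) ^ (2 * i + 5) ≤ 0 :=
          (show Odd (2 * i + 5) from ⟨i + 2, by ring⟩).pow_nonpos (by linarith [hx.2])
        have : 0 ≤ -(x - 1) ^ (2 * i + 5) *
            ((x + 1) ^ 2 * Polynomial.eval x (jacobiPoly (2 * i + 5) 2 j) ^ 2) :=
          mul_nonneg (by linarith) (by positivity)
        linarith
    simp only [Polynomial.eval_neg, intervalIntegral.integral_neg] at this
    rw [neg_div, neg_mul_comm]
    positivity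
  · refine integral_eval_pos ?_ (by norm_num) fun x _ => ?_
    · exact mul_ne_zero (mul_ne_zero (mul_ne_zero (pow_ne_zero _ hX1) (pow_ne_zero _ hX2))
        (jacobiPoly_ne_zero _ _ _)) (jacobiPoly_ne_zero _ _ _)
    · rw [mul_assoc, ← sq]
      simp only [Polynomial.eval_mul, Polynomial.eval_pow]
      positivity

theorem integral_cellFun_mul (i j k l : ℕ) :
    ∫ x in refTriangle, MvPolynomial.eval x (cellFun i j) * MvPolynomial.eval x (cellFun k l) =
      if i = k ∧ j = l then 1 else 0 := by
  have e (x : Fin 2 → ℝ) :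
      MvPolynomial.eval x (cellFun i j) * MvPolynomial.eval x (cellFun k l) =
      (1 / Real.sqrt (l2NormSq (cellFunRaw i j)) * (1 / Real.sqrt (l2NormSq (cellFunRaw k l)))) *
        (MvPolynomial.eval x (cellFunRaw i j) * MvPolynomial.eval x (cellFunRaw k l)) := by
    simp only [cellFun, map_mul, MvPolynomial.eval_C]
    ring
  simp only [e]
  rw [MeasureTheory.integral_const_mul]
  split_ifs with h
  · obtain ⟨rfl, rfl⟩ := h
    have hpos := l2NormSq_cellFunRaw_pos i j
    have e2 : ∫ x in refTriangle,
        MvPolynomial.eval x (cellFunRaw i j) * MvPolynomial.eval x (cellFunRaw i j) =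
        l2NormSq (cellFunRaw i j) := by simp only [l2NormSq, sq]
    rw [e2, ← mul_div_mul_comm, Real.mul_self_sqrt hpos.le]
    field_simp
  · rw [integral_cellFunRaw_mul_eq_zero (by tauto), mul_zero]

theorem l2NormSq_sum_of_orthonormal {ι : Type*} [Fintype ι] [DecidableEq ι]
    {f : ι → MvPolynomial (Fin 2) ℝ}
    (h : ∀ k l, ∫ x in refTriangle, MvPolynomial.eval x (f k) * MvPolynomial.eval x (f l) =
      if k = l then 1 else 0) (α : ι → ℝ) :
    l2NormSq (∑ k, α k • f k) = ∑ k, α k ^ 2 := by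
  have hc (k l : ι) : MeasureTheory.IntegrableOn (fun x =>
      α k * α l * (MvPolynomial.eval x (f k) * MvPolynomial.eval x (f l))) refTriangle :=
    integrableOn_refTriangle (((MvPolynomial.continuous_eval _).mul
      (MvPolynomial.continuous_eval _)).const_mul _)
  simp only [l2NormSq, map_sum, MvPolynomial.smul_eval, sq (∑ _, _), Finset.sum_mul_sum,
    mul_mul_mul_comm (α _)]
  rw [MeasureTheory.integral_finsetSum _ fun k _ =>
    MeasureTheory.integrable_finsetSum _ fun l _ => hc k l]
  refine Finset.sum_congr rfl fun k _ => ?_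
  rw [MeasureTheory.integral_finsetSum _ fun l _ => hc k l]
  simp only [MeasureTheory.integral_const_mul, h]
  simp [sq]

theorem eval_cellFun_eq_zero (i j : ℕ) {x : Fin 2 → ℝ} {k : Fin 3} (h : baryAt x k = 0) :
    MvPolynomial.eval x (cellFun i j) = 0 := by
  have h3 : baryAt x 0 * baryAt x 1 * baryAt x 2 = 0 := by
    fin_cases k
    · rw [show baryAt x 0 = 0 from h, zero_mul, zero_mul]
    · rw [show baryAt x 1 = 0 from h, mul_zero, zero_mul]
    · rw [show baryAt x 2 = 0 from h, mul_zero]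
  simp only [cellFun, cellFunRaw, map_mul, eval_bary, h3, zero_mul, mul_zero]

/-! ### Degrees of the basis functions -/

theorem totalDegree_bary_le (i : Fin 3) : (bary i).totalDegree ≤ 1 := by
  fin_cases i
  · simp only [bary]
    refine (MvPolynomial.totalDegree_sub _ _).trans (max_le ?_ (by simp))
    refine (MvPolynomial.totalDegree_sub _ _).trans (by simp)
  · simp [bary]
  · simp [bary]

theorem totalDegree_edgeFun_le (e₁ e₂ : Fin 3) (i : ℕ) : (edgeFun e₁ e₂ i).totalDegree ≤ i + 2 := by
  refine (MvPolynomial.totalDegree_mul _ _).trans ?_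
  rw [MvPolynomial.totalDegree_C, zero_add]
  exact totalDegree_scaledPoly_le _ _
    ((MvPolynomial.totalDegree_sub _ _).trans
      (max_le (totalDegree_bary_le _) (totalDegree_bary_le _)))
    ((MvPolynomial.totalDegree_add _ _).trans
      (max_le (totalDegree_bary_le _) (totalDegree_bary_le _)))

theorem totalDegree_aeval_le {P : Polynomial ℝ} {n : ℕ} (hP : P.natDegree ≤ n)
    {Q : MvPolynomial (Fin 2) ℝ} (hQ : Q.totalDegree ≤ 1) :
    (Polynomial.aeval Q P).totalDegree ≤ n := by
  rw [Polynomial.aeval_eq_sum_range' (Nat.lt_succ_of_le hP)]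
  refine MvPolynomial.totalDegree_finsetSum_le fun k hk => ?_
  have hk' : k ≤ n := Nat.lt_succ_iff.mp (Finset.mem_range.mp hk)
  refine (MvPolynomial.totalDegree_smul_le _ _).trans ?_
  have h1 := (MvPolynomial.totalDegree_pow Q k).trans (Nat.mul_le_mul_left k hQ)
  omega

theorem totalDegree_cellFun_le (i j : ℕ) : (cellFun i j).totalDegree ≤ i + j + 3 := by
  have h0 := totalDegree_bary_le 0
  have h1 := totalDegree_bary_le 1
  have h2 := totalDegree_bary_le 2
  have h3 : (scaledPoly i (jacobiPoly 2 2 i) (bary 0 - bary 1) (bary 0 + bary 1)).totalDegree ≤ i :=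
    totalDegree_scaledPoly_le _ _ ((MvPolynomial.totalDegree_sub _ _).trans (max_le h0 h1))
      ((MvPolynomial.totalDegree_add _ _).trans (max_le h0 h1))
  have h4 : (2 * bary 2 - 1 : MvPolynomial (Fin 2) ℝ).totalDegree ≤ 1 := by
    refine (MvPolynomial.totalDegree_sub _ _).trans (max_le ?_ (by simp))
    have : (2 : MvPolynomial (Fin 2) ℝ) = MvPolynomial.C 2 :=
      (map_ofNat MvPolynomial.C 2).symm
    refine (MvPolynomial.totalDegree_mul _ _).trans ?_
    rw [this, MvPolynomial.totalDegree_C]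
    omega
  have h5 := totalDegree_aeval_le (natDegree_jacobiPoly_le (2 * i + 5) 2 j) h4
  have m1 := MvPolynomial.totalDegree_mul (bary 0) (bary 1)
  have m2 := MvPolynomial.totalDegree_mul (bary 0 * bary 1) (bary 2)
  have m3 := MvPolynomial.totalDegree_mul (bary 0 * bary 1 * bary 2)
    (scaledPoly i (jacobiPoly 2 2 i) (bary 0 - bary 1) (bary 0 + bary 1))
  have m4 := MvPolynomial.totalDegree_mul (bary 0 * bary 1 * bary 2 *
    scaledPoly i (jacobiPoly 2 2 i) (bary 0 - bary 1) (bary 0 + bary 1))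
    (Polynomial.aeval (2 * bary 2 - 1) (jacobiPoly (2 * i + 5) 2 j))
  refine (MvPolynomial.totalDegree_mul _ _).trans ?_
  rw [MvPolynomial.totalDegree_C, zero_add, cellFunRaw]
  omega

/-! ### Vertex, edge and cell parts -/

theorem l2NormSq_add_le (f g : MvPolynomial (Fin 2) ℝ) :
    l2NormSq (f + g) ≤ 2 * l2NormSq f + 2 * l2NormSq g := by
  have hi (f : MvPolynomial (Fin 2) ℝ) := integrableOn_refTriangle (continuous_eval_sq f)
  simp only [l2NormSq]
  rw [← MeasureTheory.integral_const_mul, ← MeasureTheory.integral_const_mul,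
    ← MeasureTheory.integral_add ((hi f).const_mul 2) ((hi g).const_mul 2)]
  refine MeasureTheory.integral_mono (hi _) (((hi f).const_mul 2).add ((hi g).const_mul 2))
    fun x => ?_
  simp only [map_add]
  nlinarith [sq_nonneg (MvPolynomial.eval x f - MvPolynomial.eval x g)]

theorem l2NormSq_smul (c : ℝ) (f : MvPolynomial (Fin 2) ℝ) :
    l2NormSq (c • f) = c ^ 2 * l2NormSq f := by
  simp only [l2NormSq, MvPolynomial.smul_eval, mul_pow, MeasureTheory.integral_const_mul]

theorem l2NormSq_sub_le (f g : MvPolynomial (Fin 2) ℝ) :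
    l2NormSq (f - g) ≤ 2 * l2NormSq f + 2 * l2NormSq g := by
  have h := l2NormSq_add_le f ((-1 : ℝ) • g)
  rw [l2NormSq_smul, neg_one_smul, ← sub_eq_add_neg] at h
  linarith

theorem l2NormSq_sum_le {ι : Type*} [Fintype ι] (f : ι → MvPolynomial (Fin 2) ℝ) :
    l2NormSq (∑ k, f k) ≤ Fintype.card ι * ∑ k, l2NormSq (f k) := by
  have hi (f : MvPolynomial (Fin 2) ℝ) := integrableOn_refTriangle (continuous_eval_sq f)
  simp only [l2NormSq]
  rw [← MeasureTheory.integral_finsetSum _ fun k _ => hi (f k), ← MeasureTheory.integral_const_mul]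
  refine MeasureTheory.integral_mono (hi _)
    ((MeasureTheory.integrable_finsetSum _ fun k _ => hi (f k)).const_mul _) fun x => ?_
  simp only [map_sum]
  exact sq_sum_le_card_mul_sum_sq

theorem l2NormSq_bary_le (j : Fin 3) : l2NormSq (bary j) ≤ 1 := by
  have h1 : ∫ _x in refTriangle, (1 : ℝ) = 1 / 2 := by
    rw [integral_refTriangle_duffy continuous_const]
    norm_num
  refine le_trans ?_ (by norm_num : (1 / 2 : ℝ) ≤ 1)
  rw [← h1]
  refine MeasureTheory.setIntegral_mono_on (integrableOn_refTriangle (continuous_eval_sq _))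
    (integrableOn_refTriangle continuous_const) measurableSet_refTriangle fun x hx => ?_
  rw [mem_refTriangle_iff] at hx
  have hle := Finset.single_le_sum (fun i _ => hx i) (Finset.mem_univ j)
  rw [sum_baryAt] at hle
  rw [eval_bary]
  exact pow_le_one₀ (hx j) hle

/-- The vertex part of an expansion in the hierarchical basis. -/
noncomputable def vertexPart {p : ℕ} (α : BasisIndex p → ℝ) : MvPolynomial (Fin 2) ℝ :=
  ∑ j, α (.inl j) • bary j

/-- The coefficients of the functions of the edge `m`, continued by zero. -/
noncomputable def edgeCoeff {p : ℕ} (α : BasisIndex p → ℝ) (m : Fin 3) (i : ℕ) : ℝ :=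
  if h : i < p - 1 then α (.inr (.inl (m, ⟨i, h⟩))) else 0

/-- The part of an expansion in the hierarchical basis that belongs to the edge `m`. -/
noncomputable def edgePart (o : Fin 3 → Bool) {p : ℕ} (α : BasisIndex p → ℝ) (m : Fin 3) :
    MvPolynomial (Fin 2) ℝ :=
  ∑ i ∈ Finset.range (p - 1), edgeCoeff α m i • edgeFun (edgeStart o m) (edgeEnd o m) i

/-- The cell part of an expansion in the hierarchical basis. -/
noncomputable def cellPart {p : ℕ} (α : BasisIndex p → ℝ) : MvPolynomial (Fin 2) ℝ :=
  ∑ k : (Σ i : Fin (p - 2), Fin (p - 2 - i)), α (.inr (.inr k)) • cellFun k.1 k.2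

theorem sum_smul_basisFun (o : Fin 3 → Bool) {p : ℕ} (α : BasisIndex p → ℝ) :
    ∑ k, α k • basisFun o p k = vertexPart α + ∑ m, edgePart o α m + cellPart α := by
  rw [Fintype.sum_sum_type, Fintype.sum_sum_type, Fintype.sum_prod_type, ← add_assoc]
  congr 2
  refine Finset.sum_congr rfl fun m _ => ?_
  rw [edgePart, Finset.sum_range]
  exact Finset.sum_congr rfl fun i _ => by simp [edgeCoeff, basisFun]

theorem coeffNormSq_eq_add {p : ℕ} (α : BasisIndex p → ℝ) :
    coeffNormSq α = ∑ j, α (.inl j) ^ 2 +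
      ∑ m, ∑ i ∈ Finset.range (p - 1), edgeCoeff α m i ^ 2 +
      ∑ k : (Σ i : Fin (p - 2), Fin (p - 2 - i)), α (.inr (.inr k)) ^ 2 := by
  simp only [coeffNormSq, sq_abs, Fintype.sum_sigma]
  congr 2
  refine Finset.sum_congr rfl fun m _ => ?_
  rw [Finset.sum_range]
  exact Finset.sum_congr rfl fun i _ => by simp [edgeCoeff]

theorem coeffNormSq_eq_sum {p : ℕ} (α : BasisIndex p → ℝ) : coeffNormSq α = ∑ k, α k ^ 2 := by
  simp only [coeffNormSq, sq_abs, Fintype.sum_sum_type, Fintype.sum_prod_type, Fintype.sum_sigma,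
    add_assoc]

theorem edgeStart_ne_edgeEnd (o : Fin 3 → Bool) (m : Fin 3) : edgeStart o m ≠ edgeEnd o m := by
  unfold edgeStart edgeEnd
  cases o m <;> fin_cases m <;> simp

theorem exists_ne_of_edge_ne (o : Fin 3 → Bool) {m n : Fin 3} (h : n ≠ m) :
    (edgeStart o n ≠ edgeStart o m ∧ edgeStart o n ≠ edgeEnd o m) ∨
      (edgeEnd o n ≠ edgeStart o m ∧ edgeEnd o n ≠ edgeEnd o m) := by
  unfold edgeStart edgeEnd
  cases o m <;> cases o n <;> revert m n <;> decide

theorem l2NormSq_vertexPart_le {p : ℕ} (α : BasisIndex p → ℝ) :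
    l2NormSq (vertexPart α) ≤ 3 * ∑ j, α (.inl j) ^ 2 := by
  refine (l2NormSq_sum_le _).trans ?_
  rw [Fintype.card_fin]
  push_cast
  gcongr with j
  rw [l2NormSq_smul]
  exact mul_le_of_le_one_right (sq_nonneg _) (l2NormSq_bary_le j)

theorem l2NormSq_sum_edgePart_le (o : Fin 3 → Bool) {p : ℕ} (α : BasisIndex p → ℝ) :
    l2NormSq (∑ m, edgePart o α m) ≤
      6 * ∑ m, ∑ i ∈ Finset.range (p - 1), edgeCoeff α m i ^ 2 := by
  refine (l2NormSq_sum_le _).trans ?_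
  rw [Fintype.card_fin]
  have h := Finset.sum_le_sum fun m (_ : m ∈ Finset.univ) =>
    l2NormSq_sum_edgeFun_le (edgeStart_ne_edgeEnd o m) (p - 1) (edgeCoeff α m)
  rw [← Finset.mul_sum] at h
  simp only [edgePart]
  push_cast
  linarith

theorem l2NormSq_cellPart {p : ℕ} (α : BasisIndex p → ℝ) :
    l2NormSq (cellPart α) =
      ∑ k : (Σ i : Fin (p - 2), Fin (p - 2 - i)), α (.inr (.inr k)) ^ 2 := by
  refine l2NormSq_sum_of_orthonormal (f := fun k : (Σ i : Fin (p - 2), Fin (p - 2 - i)) =>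
    cellFun k.1 k.2) (fun k l => ?_) fun k => α (.inr (.inr k))
  rw [integral_cellFun_mul]
  obtain ⟨i, j⟩ := k
  obtain ⟨i', j'⟩ := l
  refine if_congr ?_ rfl rfl
  constructor
  · rintro ⟨h1, h2⟩
    obtain rfl := Fin.ext h1
    obtain rfl := Fin.ext h2
    rfl
  · rintro h
    cases h
    simp

/-! ### Vertex values and edge traces of an expansion -/

theorem eval_cellPart_eq_zero {p : ℕ} (α : BasisIndex p → ℝ) {x : Fin 2 → ℝ} {k : Fin 3}
    (h : baryAt x k = 0) : MvPolynomial.eval x (cellPart α) = 0 := by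
  rw [cellPart, map_sum]
  exact Finset.sum_eq_zero fun l _ => by
    rw [MvPolynomial.smul_eval, eval_cellFun_eq_zero _ _ h, mul_zero]

theorem eval_edgePart_eq_zero (o : Fin 3 → Bool) {p : ℕ} (α : BasisIndex p → ℝ) {m : Fin 3}
    {x : Fin 2 → ℝ} (h : baryAt x (edgeStart o m) = 0 ∨ baryAt x (edgeEnd o m) = 0) :
    MvPolynomial.eval x (edgePart o α m) = 0 := by
  rw [edgePart, map_sum]
  exact Finset.sum_eq_zero fun i _ => by
    rw [MvPolynomial.smul_eval, eval_edgeFun_eq_zero i h, mul_zero]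

theorem eval_vertexPart {p : ℕ} (α : BasisIndex p → ℝ) (x : Fin 2 → ℝ) :
    MvPolynomial.eval x (vertexPart α) = ∑ j, α (.inl j) * baryAt x j := by
  simp [vertexPart, eval_bary]

/-- The coefficients of the vertex functions are the values at the vertices. -/
theorem eval_vertex_sum_smul_basisFun (o : Fin 3 → Bool) {p : ℕ} (α : BasisIndex p → ℝ)
    (j : Fin 3) : MvPolynomial.eval (vertex j) (∑ k, α k • basisFun o p k) = α (.inl j) := by
  have hcell : MvPolynomial.eval (vertex j) (cellPart α) = 0 := by
    refine eval_cellPart_eq_zero α (k := j + 1) ?_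
    rw [baryAt_vertex, if_neg (by simp)]
  have hedge (m : Fin 3) : MvPolynomial.eval (vertex j) (edgePart o α m) = 0 := by
    refine eval_edgePart_eq_zero o α ?_
    have := edgeStart_ne_edgeEnd o m
    simp only [baryAt_vertex]
    by_cases h : edgeStart o m = j
    · exact Or.inr (if_neg fun h' => this (h.trans h'.symm))
    · exact Or.inl (if_neg h)
  rw [sum_smul_basisFun, map_add, map_add, map_sum, eval_vertexPart, hcell,
    Finset.sum_eq_zero fun m _ => hedge m]
  simp [baryAt_vertex]

/-- On an edge, only the vertex functions of its end points and its own edge functions do not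
vanish. -/
theorem edgeTrace_sum_smul_basisFun (o : Fin 3 → Bool) {p : ℕ} (α : BasisIndex p → ℝ)
    (m : Fin 3) :
    edgeTrace (edgeStart o m) (edgeEnd o m) (∑ k, α k • basisFun o p k) =
      Polynomial.C ((α (.inl (edgeEnd o m)) + α (.inl (edgeStart o m))) / 2) +
      Polynomial.C ((α (.inl (edgeEnd o m)) - α (.inl (edgeStart o m))) / 2) * Polynomial.X +
      edgeBubble (p - 1) (edgeCoeff α m) := by
  have hne := edgeStart_ne_edgeEnd o m
  refine Polynomial.funext fun s => ?_
  have hpt := fun k => baryAt_edgePoint (edgeStart o m) (edgeEnd o m) k s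
  have hcell : MvPolynomial.eval (edgePoint (edgeStart o m) (edgeEnd o m) s) (cellPart α) = 0 := by
    obtain ⟨k, h1, h2⟩ : ∃ k, k ≠ edgeStart o m ∧ k ≠ edgeEnd o m := by
      generalize edgeStart o m = a
      generalize edgeEnd o m = b
      revert a b; decide
    exact eval_cellPart_eq_zero α (k := k) (by rw [hpt, if_neg h1, if_neg h2, add_zero])
  have hedge : MvPolynomial.eval (edgePoint (edgeStart o m) (edgeEnd o m) s)
      (∑ n, edgePart o α n) = (edgeBubble (p - 1) (edgeCoeff α m)).eval s := by
    rw [map_sum, Finset.sum_eq_single m]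
    · rw [edgePart, map_sum, eval_edgeBubble]
      refine Finset.sum_congr rfl fun i _ => ?_
      rw [MvPolynomial.smul_eval, eval_edgePoint_edgeFun hne, mul_assoc]
    · intro n _ hn
      refine eval_edgePart_eq_zero o α ?_
      rcases exists_ne_of_edge_ne o hn with h | h
      · exact Or.inl (by rw [hpt, if_neg h.1, if_neg h.2, add_zero])
      · exact Or.inr (by rw [hpt, if_neg h.1, if_neg h.2, add_zero])
    · simp
  rw [eval_edgeTrace, sum_smul_basisFun, map_add, map_add, hcell, hedge, eval_vertexPart]
  simp only [hpt, mul_add, mul_ite, mul_zero, Finset.sum_add_distrib, Finset.sum_ite_eq',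
    Finset.mem_univ, if_true, Polynomial.eval_add, Polynomial.eval_mul, Polynomial.eval_C,
    Polynomial.eval_X]
  ring

theorem sum_edgeCoeff_sq_le (o : Fin 3 → Bool) {p : ℕ} (α : BasisIndex p → ℝ) (m : Fin 3) :
    ∑ i ∈ Finset.range (p - 1), edgeCoeff α m i ^ 2 ≤
      ∫ s in (-1 : ℝ)..1, (Polynomial.derivative (edgeTrace (edgeStart o m) (edgeEnd o m)
        (∑ k, α k • basisFun o p k))).eval s ^ 2 := by
  have h := integral_const_add_derivative_edgeBubble_sq (p - 1) (edgeCoeff α m)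
    ((α (.inl (edgeEnd o m)) - α (.inl (edgeStart o m))) / 2)
  rw [edgeTrace_sum_smul_basisFun]
  simp only [Polynomial.derivative_add, Polynomial.derivative_C, zero_add,
    Polynomial.derivative_C_mul, Polynomial.derivative_X, mul_one, Polynomial.eval_add,
    Polynomial.eval_C]
  rw [h]
  exact le_add_of_nonneg_left (by positivity)

theorem totalDegree_basisFun_le (o : Fin 3 → Bool) {p : ℕ} (hp : 1 ≤ p) (k : BasisIndex p) :
    (basisFun o p k).totalDegree ≤ p := by
  rcases k with j | ⟨m, i⟩ | ⟨i, j⟩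
  · exact (totalDegree_bary_le j).trans hp
  · have := i.2
    exact (totalDegree_edgeFun_le _ _ _).trans (by omega)
  · have := i.2
    have := j.2
    exact (totalDegree_cellFun_le _ _).trans (by omega)

theorem totalDegree_sum_smul_basisFun_le (o : Fin 3 → Bool) {p : ℕ} (hp : 1 ≤ p)
    (α : BasisIndex p → ℝ) : (∑ k, α k • basisFun o p k).totalDegree ≤ p :=
  MvPolynomial.totalDegree_finsetSum_le fun k _ =>
    (MvPolynomial.totalDegree_smul_le _ _).trans (totalDegree_basisFun_le o hp k)

/-! ### Norm estimates -/

theorem l2NormSq_sum_smul_basisFun_le (o : Fin 3 → Bool) {p : ℕ} (α : BasisIndex p → ℝ) :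
    l2NormSq (∑ k, α k • basisFun o p k) ≤ 24 * coeffNormSq α := by
  rw [sum_smul_basisFun, coeffNormSq_eq_add]
  have h1 := l2NormSq_add_le (vertexPart α + ∑ m, edgePart o α m) (cellPart α)
  have h2 := l2NormSq_add_le (vertexPart α) (∑ m, edgePart o α m)
  have h3 := l2NormSq_vertexPart_le α
  have h4 := l2NormSq_sum_edgePart_le o α
  rw [l2NormSq_cellPart] at h1
  have p1 : 0 ≤ ∑ j, α (.inl j) ^ 2 := Finset.sum_nonneg fun _ _ => sq_nonneg _
  have p2 : 0 ≤ ∑ k : (Σ i : Fin (p - 2), Fin (p - 2 - i)), α (.inr (.inr k)) ^ 2 :=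
    Finset.sum_nonneg fun _ _ => sq_nonneg _
  linarith

/-- As the cell functions are orthonormal and the other parts are `L²` stable, only the vertex and
the edge coefficients have to be controlled. -/
theorem coeffNormSq_le_add (o : Fin 3 → Bool) {p : ℕ} (α : BasisIndex p → ℝ) :
    coeffNormSq α ≤ 2 * l2NormSq (∑ k, α k • basisFun o p k) + 25 * (∑ j, α (.inl j) ^ 2 +
      ∑ m, ∑ i ∈ Finset.range (p - 1), edgeCoeff α m i ^ 2) := by
  have h1 := l2NormSq_sub_le (∑ k, α k • basisFun o p k) (vertexPart α + ∑ m, edgePart o α m)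
  have h2 := l2NormSq_add_le (vertexPart α) (∑ m, edgePart o α m)
  have h3 := l2NormSq_vertexPart_le α
  have h4 := l2NormSq_sum_edgePart_le o α
  have e : ∑ k, α k • basisFun o p k - (vertexPart α + ∑ m, edgePart o α m) = cellPart α := by
    rw [sum_smul_basisFun, add_sub_cancel_left]
  rw [e, l2NormSq_cellPart] at h1
  rw [coeffNormSq_eq_add]
  have p1 : 0 ≤ ∑ j, α (.inl j) ^ 2 := Finset.sum_nonneg fun _ _ => sq_nonneg _
  have p2 : 0 ≤ ∑ m, ∑ i ∈ Finset.range (p - 1), edgeCoeff α m i ^ 2 :=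
    Finset.sum_nonneg fun _ _ => Finset.sum_nonneg fun _ _ => sq_nonneg _
  linarith

theorem coeffNormSq_le_l2NormSq (o : Fin 3 → Bool) {p : ℕ} (hp : 1 ≤ p) (α : BasisIndex p → ℝ) :
    coeffNormSq α ≤ 19202 * p ^ 6 * l2NormSq (∑ k, α k • basisFun o p k) := by
  have h0 := coeffNormSq_le_add o α
  have hdeg := totalDegree_sum_smul_basisFun_le o hp α
  have hvert := eval_vertex_sum_smul_basisFun o α
  have hedge := sum_edgeCoeff_sq_le o α
  set u := ∑ k, α k • basisFun o p k
  have hu := l2NormSq_nonneg u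
  have hp' : (1 : ℝ) ≤ p := by exact_mod_cast hp
  have hV (j : Fin 3) : α (.inl j) ^ 2 ≤ 64 * p ^ 6 * l2NormSq u := by
    have h1 := eval_sq_le_integral (natDegree_edgeTrace_le hdeg (j + 1) j) (Or.inl rfl)
    have h2 := integral_edgeTrace_sq_le hp hdeg (a := j + 1) (b := j) (by simp)
    rw [eval_edgeTrace, edgePoint_one, hvert] at h1
    calc α (.inl j) ^ 2 ≤ (p + 1) ^ 2 / 2 * (32 * p ^ 2 * l2NormSq u) :=
          h1.trans (mul_le_mul_of_nonneg_left h2 (by positivity))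
      _ ≤ (p + p) ^ 2 / 2 * (32 * p ^ 2 * l2NormSq u) := by gcongr
      _ = 64 * p ^ 4 * l2NormSq u := by ring
      _ ≤ 64 * p ^ 6 * l2NormSq u := by gcongr; norm_num
  have hE (m : Fin 3) : ∑ i ∈ Finset.range (p - 1), edgeCoeff α m i ^ 2 ≤
      192 * p ^ 6 * l2NormSq u := by
    have h1 := integral_derivative_sq_le 
      (natDegree_edgeTrace_le hdeg (edgeStart o m) (edgeEnd o m))
    have h2 := integral_edgeTrace_sq_le hp hdeg (edgeStart_ne_edgeEnd o m)
    calc _ ≤ 6 * p ^ 4 * (32 * p ^ 2 * l2NormSq u) :=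
          ((hedge m).trans h1).trans (mul_le_mul_of_nonneg_left h2 (by positivity))
      _ = 192 * p ^ 6 * l2NormSq u := by ring
  have sV := Finset.sum_le_sum fun j (_ : j ∈ Finset.univ) => hV j
  have sE := Finset.sum_le_sum fun m (_ : m ∈ Finset.univ) => hE m
  rw [Finset.sum_const, Finset.card_univ, Fintype.card_fin, nsmul_eq_mul] at sV sE
  push_cast at sV sE
  have hpu : l2NormSq u ≤ p ^ 6 * l2NormSq u := le_mul_of_one_le_left hu (one_le_pow₀ hp')
  linarith

theorem coeffNormSq_le_h1NormSq (o : Fin 3 → Bool) {p : ℕ} (hp : 1 ≤ p) (α : BasisIndex p → ℝ) :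
    coeffNormSq α ≤ 4802 * p ^ 2 * h1NormSq (∑ k, α k • basisFun o p k) := by
  have h0 := coeffNormSq_le_add o α
  have hdeg := totalDegree_sum_smul_basisFun_le o hp α
  have hvert := eval_vertex_sum_smul_basisFun o α
  have hedge := sum_edgeCoeff_sq_le o α
  generalize ∑ k, α k • basisFun o p k = u at h0 hdeg hvert hedge ⊢
  rw [h1NormSq]
  have hD {a b : Fin 3} (hab : a ≠ b) := integral_derivative_edgeTrace_sq_le hp hdeg hab
  have hu := l2NormSq_nonneg u
  have hG0 : 0 ≤ ∑ i : Fin 2, l2NormSq (MvPolynomial.pderiv i u) :=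
    Finset.sum_nonneg fun i _ => l2NormSq_nonneg _
  generalize ∑ i : Fin 2, l2NormSq (MvPolynomial.pderiv i u) = G at hD hG0 ⊢
  have hp' : (1 : ℝ) ≤ p := by exact_mod_cast hp
  have hp2 : (1 : ℝ) ≤ p ^ 2 := one_le_pow₀ hp'
  have hV (j : Fin 3) : α (.inl j) ^ 2 ≤ 48 * p ^ 2 * (l2NormSq u + G) := by
    have h1 := eval_one_sq_le_integral_add (edgeTrace (j + 1) j u)
    have h2 := integral_edgeTrace_sq_le hp hdeg (a := j + 1) (b := j) (by simp)
    have h3 := hD (a := j + 1) (b := j) (by simp)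
    rw [eval_edgeTrace, edgePoint_one, hvert] at h1
    have : 0 ≤ (p : ℝ) ^ 2 * G := by positivity
    linarith
  have hE (m : Fin 3) : ∑ i ∈ Finset.range (p - 1), edgeCoeff α m i ^ 2 ≤
      16 * p ^ 2 * (l2NormSq u + G) := by
    have h1 := hD (edgeStart_ne_edgeEnd o m)
    have h2 := hedge m
    have : 0 ≤ (p : ℝ) ^ 2 * l2NormSq u := by positivity
    linarith
  have sV := Finset.sum_le_sum fun j (_ : j ∈ Finset.univ) => hV j
  have sE := Finset.sum_le_sum fun m (_ : m ∈ Finset.univ) => hE m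
  rw [Finset.sum_const, Finset.card_univ, Fintype.card_fin, nsmul_eq_mul] at sV sE
  push_cast at sV sE
  have hpu : l2NormSq u + G ≤ p ^ 2 * (l2NormSq u + G) :=
    le_mul_of_one_le_left (add_nonneg hu hG0) hp2
  linarith

theorem h1NormSq_sum_smul_basisFun_le (o : Fin 3 → Bool) {p : ℕ} (hp : 1 ≤ p)
    (α : BasisIndex p → ℝ) :
    h1NormSq (∑ k, α k • basisFun o p k) ≤ 110616 * p ^ 4 * coeffNormSq α := by
  have h0 := l2NormSq_sum_smul_basisFun_le o α
  have hdeg := totalDegree_sum_smul_basisFun_le o hp α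
  set u := ∑ k, α k • basisFun o p k
  have h1 := l2NormSq_pderiv_le hdeg 0
  have h2 := l2NormSq_pderiv_le hdeg 1
  have hp4 : (1 : ℝ) ≤ p ^ 4 := one_le_pow₀ (by exact_mod_cast hp)
  have hpu : l2NormSq u ≤ p ^ 4 * l2NormSq u := le_mul_of_one_le_left (l2NormSq_nonneg u) hp4
  have h3 : p ^ 4 * l2NormSq u ≤ p ^ 4 * (24 * coeffNormSq α) := by gcongr
  rw [h1NormSq, Fin.sum_univ_two]
  linarith

/-! ### Dimension count -/

theorem two_mul_sum_range_sub (n : ℕ) : 2 * ∑ i ∈ Finset.range n, (n - i) = n * (n + 1) := by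
  induction n with
  | zero => simp
  | succ n ih =>
    rw [Finset.sum_range_succ']
    simp only [Nat.add_sub_add_right, Nat.sub_zero]
    rw [mul_add, ih]
    ring

theorem two_mul_card_sigma_fin_sub (n : ℕ) :
    2 * Fintype.card (Σ i : Fin n, Fin (n - i)) = n * (n + 1) := by
  rw [Fintype.card_sigma, ← two_mul_sum_range_sub, Finset.sum_range]
  simp

theorem card_basisIndex {p : ℕ} (hp : 1 ≤ p) :
    2 * Fintype.card (BasisIndex p) = (p + 1) * (p + 2) := by
  rw [Fintype.card_sum, Fintype.card_sum, Fintype.card_prod, mul_add, mul_add,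
    two_mul_card_sigma_fin_sub]
  simp only [Fintype.card_fin]
  rcases Nat.lt_or_ge p 2 with h | h
  · obtain rfl : p = 1 := by omega
    rfl
  · obtain ⟨n, rfl⟩ := Nat.exists_eq_add_of_le' h
    simp only [Nat.add_sub_cancel, Nat.add_succ_sub_one]
    ring

theorem two_mul_finrank_restrictTotalDegree (p : ℕ) :
    2 * Module.finrank ℝ (MvPolynomial.restrictTotalDegree (Fin 2) ℝ p) = (p + 1) * (p + 2) := by
  have e : {n : Fin 2 →₀ ℕ | (n.sum fun _ e => e) ≤ p} ≃
      Σ i : Fin (p + 1), Fin (p + 1 - i) :=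
    { toFun := fun n => by
        have h : n.1 0 + n.1 1 ≤ p := by
          have := n.2
          rwa [Set.mem_ofPred_eq, Finsupp.sum_fintype _ _ (by simp), Fin.sum_univ_two] at this
        exact ⟨⟨n.1 0, by omega⟩, ⟨n.1 1, by simp only; omega⟩⟩
      invFun := fun k => ⟨Finsupp.equivFunOnFinite.symm ![k.1, k.2], by
        have h1 := k.1.2
        have h2 := k.2.2
        rw [Set.mem_ofPred_eq, Finsupp.sum_fintype _ _ (by simp), Fin.sum_univ_two]
        simp
        omega⟩
      left_inv := fun n => by
        ext i
        fin_cases i <;> simp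
      right_inv := fun k => by simp }
  have hb := Module.finrank_eq_nat_card_basis (MvPolynomial.basisRestrictSupport ℝ
    {n : Fin 2 →₀ ℕ | (n.sum fun _ e => e) ≤ p})
  rw [Nat.card_congr e, Nat.card_eq_fintype_card] at hb
  rw [MvPolynomial.restrictTotalDegree, hb, two_mul_card_sigma_fin_sub]

/-- The `L²` estimate of the coefficients shows that the basis functions are linearly independent;
the rest is a count of dimensions. -/
theorem exists_basis_eq_basisFun (o : Fin 3 → Bool) {p : ℕ} (hp : 1 ≤ p) :
    ∃ b : Module.Basis (BasisIndex p) ℝ (MvPolynomial.restrictTotalDegree (Fin 2) ℝ p),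
      ∀ k, (b k : MvPolynomial (Fin 2) ℝ) = basisFun o p k := by
  set f : BasisIndex p → MvPolynomial.restrictTotalDegree (Fin 2) ℝ p := fun k =>
    ⟨basisFun o p k, (MvPolynomial.mem_restrictTotalDegree _ _ _).mpr
      (totalDegree_basisFun_le o hp k)⟩ with hf
  have hli : LinearIndependent ℝ f := by
    rw [Fintype.linearIndependent_iff]
    intro α hα
    have h0 : ∑ k, α k • basisFun o p k = 0 := by
      have := congrArg (Submodule.subtype _) hα
      simpa [hf] using this
    have h1 := coeffNormSq_le_l2NormSq o hp α
    have h2 : l2NormSq 0 = 0 := by simp [l2NormSq]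
    rw [h0, h2, mul_zero, coeffNormSq_eq_sum] at h1
    intro k
    have h3 := Finset.single_le_sum (fun i _ => sq_nonneg (α i)) (Finset.mem_univ k)
    exact pow_eq_zero_iff two_ne_zero |>.mp (le_antisymm (h3.trans h1) (sq_nonneg _))
  have hcard : Fintype.card (BasisIndex p) =
      Module.finrank ℝ (MvPolynomial.restrictTotalDegree (Fin 2) ℝ p) := by
    have h1 := card_basisIndex hp
    have h2 := two_mul_finrank_restrictTotalDegree p
    omega
  have : Nonempty (BasisIndex p) := ⟨.inl 0⟩
  exact ⟨basisOfLinearIndependentOfCardEqFinrank hli hcard, fun k => by simp [hf]⟩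

theorem mainTheorem6 :
    ∃ c₀ C₀ c₁ C₁ : ℝ, 0 < c₀ ∧ 0 < C₀ ∧ 0 < c₁ ∧ 0 < C₁ ∧
      ∀ (p : ℕ), 1 ≤ p → ∀ o : Fin 3 → Bool,
        ∃ b : Module.Basis (BasisIndex p) ℝ (MvPolynomial.restrictTotalDegree (Fin 2) ℝ p),
          (∀ k, (b k : MvPolynomial (Fin 2) ℝ) = basisFun o p k) ∧
          ∀ u : MvPolynomial.restrictTotalDegree (Fin 2) ℝ p,
            (c₀ * l2NormSq u ≤ coeffNormSq (fun k => b.repr u k) ∧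
              coeffNormSq (fun k => b.repr u k) ≤ C₀ * (p : ℝ) ^ 6 * l2NormSq u) ∧
            (c₁ * (p : ℝ) ^ (-4 : ℤ) * h1NormSq u ≤ coeffNormSq (fun k => b.repr u k) ∧
              coeffNormSq (fun k => b.repr u k) ≤ C₁ * (p : ℝ) ^ 2 * h1NormSq u) := by

  -- `24`, `19202`, `110616`, `4802` are the constants of the four norm estimates
  refine ⟨1 / 24, 19202, 1 / 110616, 4802, by norm_num, by norm_num, by norm_num, by norm_num,
    fun p hp o => ?_⟩
  obtain ⟨b, hb⟩ := exists_basis_eq_basisFun o hp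
  refine ⟨b, hb, fun u => ?_⟩
  have hu : (u : MvPolynomial (Fin 2) ℝ) = ∑ k, b.repr u k • basisFun o p k := by
    have h := congrArg Subtype.val (b.sum_repr u)
    simpa only [AddSubmonoidClass.coe_finsetSum, SetLike.val_smul, hb] using h.symm
  have hp' : (0 : ℝ) < p := by exact_mod_cast hp
  rw [hu]
  refine ⟨⟨?_, coeffNormSq_le_l2NormSq o hp _⟩, ?_, coeffNormSq_le_h1NormSq o hp _⟩
  · have h := l2NormSq_sum_smul_basisFun_le o fun k => b.repr u k
    linarith
  · have h := h1NormSq_sum_smul_basisFun_le o hp fun k => b.repr u k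
    have e : (1 / 110616 : ℝ) * (p : ℝ) ^ (-4 : ℤ) = (110616 * (p : ℝ) ^ 4)⁻¹ := by
      rw [zpow_neg, mul_inv]
      norm_cast
      norm_num
    rw [e, inv_mul_le_iff₀ (by positivity)]
    exact h
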